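/- Let $\mathbb F$ be a field or skew field, let $V$ be a finite-dimensional right vector space over $\mathbb F$, let $U\subseteq V$ be a subspace, and let $\mathcal A$ be a linear mapping of one of the types $$U\to V,\qquad V\to U,\qquad V/U\to V,\qquad V\to V/U .$$ Call a basis $e_1,\dots,e_n$ of $V$ \emph{adapted} if $e_1,\dots,e_m$ is a basis of $U$ (for $U\to V$ and $V\to U$), respectively, $e_{m+1},\dots,e_n$ is a basis of $U$ (for $V/U\to V$ and $V\to V/U$). Let $A_e$ be the matrix of $\mathcal A$ in the basis $e_1,\dots,e_n$ of $V$ and the basis $e_1,\dots,e_m$ of $U$, respectively, $e_1+U,\dots,e_m+U$ of $V/U$. Put $M_e:=A_e^T$ for $U\to V$ and $V/U\to V$, and $M_e:=A_e$ for $V\to U$ and $V\to V/U$; divide $M_e=[A|B]$ into blocks with $A$ of size $m\times m$. The block-direct sum of block matrices is $[A_1|B_1]\uplus[A_2|B_2]:=[A_1\oplus A_2\,|\,B_1\oplus B_2]$ (blocks may have no rows or no columns). Let $J_q(\lambda)$ be the $q\times q$ upper triangular Jordan block with eigenvalue $\lambda$, let $E_q$ be the $q\times 1$ column $(0,\dots,0,1)^T$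 if $q\ge 1$, and let $E_0$ be the $0\times1$ matrix. The \emph{singular summands} are $$[J_q(0)|0_{q0}]\ (q\ge1),\qquad [J_q(0)|E_q]\ (q\ge 0).$$ For a square matrix $K$ put $K^\circ:=K^T$ for $U\to V$ and $V/U\to V$, and $K^\circ:=K$ for $V\to U$ and $V\to V/U$. (If $\mathbb F$ is a field, then $K^\circ$ is nonsingular if and only if $K$ is, and $K_1^\circ,K_2^\circ$ are similar if and only if $K_1,K_2$ are, so $K^\circ$ may be replaced by $K$ below.) (a) There is an adapted basis in which $M_e$ is a block-direct sum of a matrix $[K|0_{p0}]$ with $p\times p$ matrix $K$ such that $K^\circ$ is nonsingular, and of singular summands (the summand $[K|0_{p0}]$ or the singular summands may be absent). The block $K$ is determined by $\mathcal A$ uniquely up to similarity of $K^\circ$, and the singular summands are determined by $\mathcal A$ uniquely up to permutation. (b) If $\mathbb F=\mathbb C$, then in every decomposition as in (a) one can, by a change of the adapted basis, replace the summand $[K|0_{p0}]$ by a block-direct sum of matrices $[J_q(\lambda)|0_{q0}]$ with $q\ge 1$ and $\lambda\neq0$, where the direct sum of these $J_q(\lambda)$ is similar to $K$. The obtained block-direct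 sum of matrices $[J_q(\lambda)|0_{q0}]$ $(q\ge1,\ \lambda\ne0)$ and singular summands exists for each $\mathcal A$ and is determined by $\mathcal A$ uniquely up to permutation of summands, and so it is a canonical matrix of $\mathcal A$. -/

import Mathlib

universe u v

noncomputable section

open MulOpposite

/-- A block matrix `[A|B]` with entries in `F`, in which `A` is square of size `rows × rows`
and `B` has size `rows × cols`.  The numbers `rows` and `cols` may be zero. -/
structure BlockMatrix (F : Type u) where
  rows : ℕ
  cols : ℕ
  left : Matrix (Fin rows) (Fin rows) F
  right : Matrix (Fin rows) (Fin cols) F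

namespace BlockMatrix

variable {F : Type u}

/-- The whole matrix `[A|B]`; its columns are indexed by `Fin rows` (the columns of `A`)
followed by `Fin cols` (the columns of `B`). -/
def toMatrix (M : BlockMatrix F) : Matrix (Fin M.rows) (Fin M.rows ⊕ Fin M.cols) F :=
  Matrix.fromCols M.left M.right

/-- The block-direct sum `[A₁|B₁] ⊎ [A₂|B₂] = [A₁ ⊕ A₂ | B₁ ⊕ B₂]`. -/
def blockSum [Zero F] (M N : BlockMatrix F) : BlockMatrix F where
  rows := M.rows + N.rows
  cols := M.cols + N.cols
  left := Matrix.reindex finSumFinEquiv finSumFinEquiv (Matrix.fromBlocks M.left 0 0 N.left)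
  right := Matrix.reindex finSumFinEquiv finSumFinEquiv (Matrix.fromBlocks M.right 0 0 N.right)

/-- The block matrix of size `0 × 0`. -/
def empty [Zero F] : BlockMatrix F := ⟨0, 0, 0, 0⟩

/-- The block-direct sum of a finite list of block matrices. -/
def listSum [Zero F] (L : List (BlockMatrix F)) : BlockMatrix F := L.foldr blockSum empty

/-- The block matrix `[K|0_{p0}]`. -/
def ofSquare [Zero F] {p : ℕ} (K : Matrix (Fin p) (Fin p) F) : BlockMatrix F := ⟨p, 0, K, 0⟩

/-- The Jordan block `J_q(a)`, upper triangular, with units on the first superdiagonal. -/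
def jordan [Zero F] [One F] (q : ℕ) (a : F) : Matrix (Fin q) (Fin q) F :=
  Matrix.of fun i j => if i = j then a else if (j : ℕ) = i + 1 then 1 else 0

/-- The column `E_q` of height `q`, whose last entry is `1` and whose other entries are `0`
(for `q = 0`, the matrix of size `0 × 1`). -/
def lastColumn [Zero F] [One F] (q : ℕ) : Matrix (Fin q) (Fin 1) F :=
  Matrix.of fun i _ => if (i : ℕ) + 1 = q then 1 else 0

/-- The singular summands: `[J_q(0)|0_{q0}]` with `q ≥ 1` and `[J_q(0)|E_q]` with `q ≥ 0`. -/
def IsSingularSummand [Zero F] [One F] (M : BlockMatrix F) : Prop :=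
  (∃ q : ℕ, 1 ≤ q ∧ M = ofSquare (jordan q 0)) ∨ (∃ q : ℕ, M = ⟨q, 1, jordan q 0, lastColumn q⟩)

/-- The nonsingular Jordan summands: `[J_q(a)|0_{q0}]` with `q ≥ 1` and `a ≠ 0`. -/
def IsRegularJordanSummand [Zero F] [One F] (M : BlockMatrix F) : Prop :=
  ∃ (q : ℕ) (a : F), 1 ≤ q ∧ a ≠ 0 ∧ M = ofSquare (jordan q a)

end BlockMatrix

/-- Similarity `K' = S⁻¹ K S` of square matrices over a (skew) field, for matrices whose sizes
are not known in advance to coincide.  Here `T` is the inverse of `S`. -/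
def SimilarMatrices {F : Type u} [Ring F] {p p' : ℕ}
    (K : Matrix (Fin p) (Fin p) F) (K' : Matrix (Fin p') (Fin p') F) : Prop :=
  p = p' ∧ ∃ (S : Matrix (Fin p) (Fin p') F) (T : Matrix (Fin p') (Fin p) F),
    S * T = 1 ∧ T * S = 1 ∧ K' = T * K * S

/-- The matrix `[a_{ij}]` of a linear mapping `f : X → Y` of right `F`-spaces in bases `b` of `X`
and `c` of `Y`, that is, `f (b_j) = ∑ i, c_i a_{ij}`.  A right `F`-space is a module over the
opposite ring `Fᵐᵒᵖ`. -/
def rightMatrix {F : Type u} [DivisionRing F] {X Y : Type*}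
    [AddCommGroup X] [Module Fᵐᵒᵖ X] [AddCommGroup Y] [Module Fᵐᵒᵖ Y] {ι κ : Type*}
    (f : X →ₗ[Fᵐᵒᵖ] Y) (b : Module.Basis ι Fᵐᵒᵖ X) (c : Module.Basis κ Fᵐᵒᵖ Y) :
    Matrix κ ι F :=
  Matrix.of fun i j => unop (c.repr (f (b j)) i)

/-- A linear mapping of one of the four types `U → V`, `V → U`, `V/U → V`, `V → V/U`, in which
`V` is a right vector space over `F` and `U` is its subspace. -/
inductive SubspaceMapping {F : Type u} [DivisionRing F] {V : Type v} [AddCommGroup V]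
    [Module Fᵐᵒᵖ V] (U : Submodule Fᵐᵒᵖ V) : Type v
  | subToSpace (A : U →ₗ[Fᵐᵒᵖ] V) : SubspaceMapping U
  | spaceToSub (A : V →ₗ[Fᵐᵒᵖ] U) : SubspaceMapping U
  | quotToSpace (A : (V ⧸ U) →ₗ[Fᵐᵒᵖ] V) : SubspaceMapping U
  | spaceToQuot (A : V →ₗ[Fᵐᵒᵖ] (V ⧸ U)) : SubspaceMapping U

namespace SubspaceMapping

variable {F : Type u} [DivisionRing F] {V : Type v} [AddCommGroup V] [Module Fᵐᵒᵖ V]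
  {U : Submodule Fᵐᵒᵖ V}

/-- Let `e` be a basis of `V`, indexed by `1, …, m` (the left summand) followed by
`m + 1, …, n` (the right summand).  This says that `e` is adapted to `U`, that is,
`e_1, …, e_m` is a basis of `U` for `U → V` and `V → U`, and `e_{m+1}, …, e_n` is a basis of `U`
for `V/U → V` and `V → V/U`; and that `N` is `A_eᵀ` for `U → V` and `V/U → V`, and `A_e` for
`V → U` and `V → V/U`, where `A_e` is the matrix of the mapping in the basis `e` of `V` and the
basis `e_1, …, e_m` of `U`, respectively, `e_1 + U, …, e_m + U` of `V/U`. -/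
def HasMatrix {m k : ℕ} (e : Module.Basis (Fin m ⊕ Fin k) Fᵐᵒᵖ V)
    (N : Matrix (Fin m) (Fin m ⊕ Fin k) F) : SubspaceMapping U → Prop
  | subToSpace A => ∃ b : Module.Basis (Fin m) Fᵐᵒᵖ U,
      (∀ i, (b i : V) = e (Sum.inl i)) ∧ (rightMatrix A b e).transpose = N
  | spaceToSub A => ∃ b : Module.Basis (Fin m) Fᵐᵒᵖ U,
      (∀ i, (b i : V) = e (Sum.inl i)) ∧ rightMatrix A e b = N
  | quotToSpace A => (∃ c : Module.Basis (Fin k) Fᵐᵒᵖ U, ∀ i, (c i : V) = e (Sum.inr i)) ∧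
      ∃ b : Module.Basis (Fin m) Fᵐᵒᵖ (V ⧸ U),
        (∀ i, b i = U.mkQ (e (Sum.inl i))) ∧ (rightMatrix A b e).transpose = N
  | spaceToQuot A => (∃ c : Module.Basis (Fin k) Fᵐᵒᵖ U, ∀ i, (c i : V) = e (Sum.inr i)) ∧
      ∃ b : Module.Basis (Fin m) Fᵐᵒᵖ (V ⧸ U),
        (∀ i, b i = U.mkQ (e (Sum.inl i))) ∧ rightMatrix A e b = N

/-- There is a basis of `V` adapted to `U` in which `A_e` (for `V → U` and `V → V/U`) or `A_eᵀ`
(for `U → V` and `V/U → V`) is the block matrix `M`. -/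
def HasForm (𝒜 : SubspaceMapping U) (M : BlockMatrix F) : Prop :=
  ∃ e : Module.Basis (Fin M.rows ⊕ Fin M.cols) Fᵐᵒᵖ V, 𝒜.HasMatrix e M.toMatrix

/-- For a diagonal block `K` of `A_e` or `A_eᵀ`, the corresponding block of the matrix `A_e`
itself: `Kᵀ` for `U → V` and `V/U → V`, and `K` for `V → U` and `V → V/U`.  Transposition of
matrices over a skew field preserves neither nonsingularity nor similarity, so both are to be
understood for this block; over a field it makes no difference. -/
def untranspose {p : ℕ} (K : Matrix (Fin p) (Fin p) F) : SubspaceMapping U →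
    Matrix (Fin p) (Fin p) F
  | subToSpace _ => K.transpose
  | spaceToSub _ => K
  | quotToSpace _ => K.transpose
  | spaceToQuot _ => K

/-- The mapping has the block-direct sum of `[K|0_{p0}]`, with `K` nonsingular, and of the list
`L` of singular summands as its matrix in an adapted basis. -/
def IsDecomposition (𝒜 : SubspaceMapping U) {p : ℕ} (K : Matrix (Fin p) (Fin p) F)
    (L : List (BlockMatrix F)) : Prop :=
  IsUnit (𝒜.untranspose K) ∧ (∀ M ∈ L, M.IsSingularSummand) ∧
    𝒜.HasForm (BlockMatrix.listSum (BlockMatrix.ofSquare K :: L))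

/-- The mapping has the block-direct sum of the list `L` as its matrix in an adapted basis, and
each member of `L` is `[J_q(a)|0_{q0}]` with `a ≠ 0` or a singular summand. -/
def IsCanonicalForm (𝒜 : SubspaceMapping U) (L : List (BlockMatrix F)) : Prop :=
  (∀ M ∈ L, M.IsRegularJordanSummand ∨ M.IsSingularSummand) ∧
    𝒜.HasForm (BlockMatrix.listSum L)

end SubspaceMapping

end

/-!
# Canonical matrices of linear mappings between a space and its subspace or quotient

A block matrix `[A|B]` with `m` rows acts on row vectors from the right and so is a *system*: a pair
of linear maps `a : W → W`, `x ↦ x A`, and `b : W → Z`, `x ↦ x B`. A change of the adapted basis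
replaces `[A|B]` by `P⁻¹[A|B]S`, where `S` is block triangular with `P` in the left upper corner. So
it is a simultaneous change of the bases of `W` and `Z`, together with the addition of columns of
one strip to those of the other: from `A` to `B` for `V → U` and `V/U → V` (`intoRight`), and from
`B` to `A` for `U → V` and `V → V/U` (`intoLeft`). For `U → V` and `V/U → V` the matrix is
transposed. Over a skew field this is repaired by passing to the opposite skew field, where `Aᵀ`
multiplies as `A` does in the reverse order; singular summands have entries `0` and `1` and do not
notice. In all four cases the matrices of a mapping in adapted bases form one equivalence class of
systems (`exists_hasForm_iff`), so that the decomposition becomes a statement about systems.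

*Existence.* Under `intoRight`, adding a multiple of `a` to `b` shows that only the values of `b` on
`ker a` matter. By Fitting's lemma, `a` is the sum of a bijective and a nilpotent map, and `b` can
be made zero on the bijective part (`exists_fitting`). In the nilpotent part a chain
`v, a v, …, aⁿ v` of maximal length splits off; if `b (aⁿ v) ≠ 0`, the complement is chosen
inside the kernel of a functional which extracts `b (aⁿ v)` (`exists_split_chain`).
If `b` is not surjective, a zero column splits off (`exists_split_zeroColumn`). Under `intoLeft`, only the restriction of `a` to `ker b`
matters. If `b` is surjective, the system is the prolongation of a smaller one which lives on
`ker b`, and prolongation maps a sum of singular summands to a sum of singular summands by replacing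
`[J_q(0)|E_q]` with `[J_{q+1}(0)|E_{q+1}]`; the decomposition follows by induction.

*Uniqueness.* An equivalence of systems intertwines the left maps on the regular summands with the
left maps of the whole systems; since no nonzero map intertwines a surjective with a nilpotent
endomorphism, it restricts to a similarity of the regular summands (`exists_linearEquiv_regular`).
Two chains of subspaces of `W` are preserved by equivalences (`chainSpace`); the differences of
their dimensions, and the number of columns of `B`, count the singular summands of each kind and of
at least a given length (`perm_of_equivalent`).

*Jordan form.* For an eigenvalue `μ` of `K`, the decomposition of the system `[K - μ|0]` is the sum
of a nonsingular matrix and of nilpotent Jordan blocks. Adding `μ` splits off the Jordan blocks of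
`K` with the eigenvalue `μ`, and the rest is smaller (`BlockMatrix.exists_jordan`). The dimensions
of the kernels of the powers of `K - μ` determine the blocks (`perm_of_equivalent_jordan`).
-/

open Matrix BlockMatrix MulOpposite

/-! ### Systems of linear maps -/

/-- The two ways in which a change of an adapted basis may mix the two strips of `[A|B]`: a linear
combination of columns of `A` may be added to columns of `B` (`intoRight`), or a linear combination
of columns of `B` may be added to columns of `A` (`intoLeft`). -/
inductive StripMixing
  | intoRight
  | intoLeft

section SystemEquivalence

variable {D : Type*} [DivisionRing D]
variable {W : Type*} [AddCommGroup W] [Module D W] {Z : Type*} [AddCommGroup Z] [Module D Z]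
variable {W' : Type*} [AddCommGroup W'] [Module D W'] {Z' : Type*} [AddCommGroup Z'] [Module D Z']
variable {W'' : Type*} [AddCommGroup W''] [Module D W'']
variable {Z'' : Type*} [AddCommGroup Z''] [Module D Z'']
variable {W₁ : Type*} [AddCommGroup W₁] [Module D W₁]
variable {Z₁ : Type*} [AddCommGroup Z₁] [Module D Z₁]
variable {W₁' : Type*} [AddCommGroup W₁'] [Module D W₁']
variable {Z₁' : Type*} [AddCommGroup Z₁'] [Module D Z₁']

/-- Equivalence of two systems `(a : W → W, b : W → Z)` and `(a' : W' → W', b' : W' → Z')`, that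
is, the coordinate-free form of equivalence of the block matrices `[A|B]` and `[A'|B']`, which act
on row vectors from the right. -/
def SystemEquiv : StripMixing → (W →ₗ[D] W) → (W →ₗ[D] Z) → (W' →ₗ[D] W') → (W' →ₗ[D] Z') → Prop
  | .intoRight, a, b, a', b' => ∃ (P : W ≃ₗ[D] W') (Q : Z ≃ₗ[D] Z') (Y : W →ₗ[D] Z'),
      (∀ w, a' (P w) = P (a w)) ∧ ∀ w, b' (P w) = Q (b w) + Y (a w)
  | .intoLeft, a, b, a', b' => ∃ (P : W ≃ₗ[D] W') (Q : Z ≃ₗ[D] Z') (X : Z →ₗ[D] W'),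
      (∀ w, a' (P w) = P (a w) + X (b w)) ∧ ∀ w, b' (P w) = Q (b w)

namespace SystemEquiv

variable {t : StripMixing} {a : W →ₗ[D] W} {b : W →ₗ[D] Z} {a' : W' →ₗ[D] W'} {b' : W' →ₗ[D] Z'}
  {a'' : W'' →ₗ[D] W''} {b'' : W'' →ₗ[D] Z''}
  {a₁ : W₁ →ₗ[D] W₁} {b₁ : W₁ →ₗ[D] Z₁} {a₁' : W₁' →ₗ[D] W₁'} {b₁' : W₁' →ₗ[D] Z₁'}

theorem of_linearEquiv (P : W ≃ₗ[D] W') (Q : Z ≃ₗ[D] Z') (ha : ∀ w, a' (P w) = P (a w))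
    (hb : ∀ w, b' (P w) = Q (b w)) : SystemEquiv t a b a' b' := by
  cases t
  · exact ⟨P, Q, 0, ha, by simpa using hb⟩
  · exact ⟨P, Q, 0, by simpa using ha, hb⟩

theorem refl (t : StripMixing) (a : W →ₗ[D] W) (b : W →ₗ[D] Z) : SystemEquiv t a b a b :=
  of_linearEquiv (.refl D W) (.refl D Z) (fun _ => rfl) fun _ => rfl

theorem comp_linearEquiv (t : StripMixing) (a : W →ₗ[D] W) (b : W →ₗ[D] Z) (Q : Z ≃ₗ[D] Z') :
    SystemEquiv t a b a (Q.toLinearMap ∘ₗ b) :=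
  of_linearEquiv (.refl D W) Q (fun _ => rfl) fun _ => rfl

theorem symm (h : SystemEquiv t a b a' b') : SystemEquiv t a' b' a b := by
  cases t
  · obtain ⟨P, Q, Y, ha, hb⟩ := h
    refine ⟨P.symm, Q.symm, -(Q.symm.toLinearMap ∘ₗ Y ∘ₗ P.symm.toLinearMap), fun w => ?_,
      fun w => ?_⟩
    · apply P.injective; simp [← ha]
    · apply Q.injective
      have h1 := hb (P.symm w)
      have h2 := ha (P.symm w)
      simp only [LinearEquiv.apply_symm_apply] at h1 h2
      simp [h1, h2]
  · obtain ⟨P, Q, X, ha, hb⟩ := h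
    refine ⟨P.symm, Q.symm, -(P.symm.toLinearMap ∘ₗ X ∘ₗ Q.symm.toLinearMap), fun w => ?_,
      fun w => ?_⟩
    · apply P.injective
      have h1 := hb (P.symm w)
      have h2 := ha (P.symm w)
      simp only [LinearEquiv.apply_symm_apply] at h1 h2
      simp [h1, h2]
    · apply Q.injective; simp [← hb]

theorem trans (h : SystemEquiv t a b a' b') (h' : SystemEquiv t a' b' a'' b'') :
    SystemEquiv t a b a'' b'' := by
  cases t
  · obtain ⟨P, Q, Y, ha, hb⟩ := h
    obtain ⟨P', Q', Y', ha', hb'⟩ := h'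
    refine ⟨P.trans P', Q.trans Q', Q'.toLinearMap ∘ₗ Y + Y' ∘ₗ P.toLinearMap, fun w => ?_,
      fun w => ?_⟩
    · simp [ha', ha]
    · simp [hb', hb, ha, add_assoc]
  · obtain ⟨P, Q, X, ha, hb⟩ := h
    obtain ⟨P', Q', X', ha', hb'⟩ := h'
    refine ⟨P.trans P', Q.trans Q', P'.toLinearMap ∘ₗ X + X' ∘ₗ Q.toLinearMap, fun w => ?_,
      fun w => ?_⟩
    · simp [ha', hb, ha, add_assoc]
    · simp [hb', hb]

theorem prodMap (h : SystemEquiv t a b a' b') (h' : SystemEquiv t a₁ b₁ a₁' b₁') :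
    SystemEquiv t (a.prodMap a₁) (b.prodMap b₁) (a'.prodMap a₁') (b'.prodMap b₁') := by
  cases t
  · obtain ⟨P, Q, Y, ha, hb⟩ := h
    obtain ⟨P', Q', Y', ha', hb'⟩ := h'
    refine ⟨P.prodCongr P', Q.prodCongr Q', Y.prodMap Y', fun w => ?_, fun w => ?_⟩
    · simp [ha', ha]
    · simp [hb', hb]
  · obtain ⟨P, Q, X, ha, hb⟩ := h
    obtain ⟨P', Q', X', ha', hb'⟩ := h'
    refine ⟨P.prodCongr P', Q.prodCongr Q', X.prodMap X', fun w => ?_, fun w => ?_⟩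
    · simp [ha', ha]
    · simp [hb', hb]

theorem prodMap_assoc (t : StripMixing) (a : W →ₗ[D] W) (b : W →ₗ[D] Z) (a' : W' →ₗ[D] W')
    (b' : W' →ₗ[D] Z') (a'' : W'' →ₗ[D] W'') (b'' : W'' →ₗ[D] Z'') :
    SystemEquiv t ((a.prodMap a').prodMap a'') ((b.prodMap b').prodMap b'')
      (a.prodMap (a'.prodMap a'')) (b.prodMap (b'.prodMap b'')) :=
  of_linearEquiv (LinearEquiv.prodAssoc D W W' W'') (LinearEquiv.prodAssoc D Z Z' Z'')
    (fun _ => rfl) fun _ => rfl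

theorem prodMap_comm (t : StripMixing) (a : W →ₗ[D] W) (b : W →ₗ[D] Z) (a' : W' →ₗ[D] W')
    (b' : W' →ₗ[D] Z') :
    SystemEquiv t (a.prodMap a') (b.prodMap b') (a'.prodMap a) (b'.prodMap b) :=
  of_linearEquiv (LinearEquiv.prodComm D W W') (LinearEquiv.prodComm D Z Z')
    (fun _ => rfl) fun _ => rfl

theorem subsingleton_prodMap [Subsingleton W'] [Subsingleton Z'] (t : StripMixing)
    (a : W →ₗ[D] W) (b : W →ₗ[D] Z) (a' : W' →ₗ[D] W') (b' : W' →ₗ[D] Z') :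
    SystemEquiv t (a'.prodMap a) (b'.prodMap b) a b := by
  refine of_linearEquiv
    { LinearMap.snd D W' W with
      invFun := fun w => (0, w), left_inv := fun _ => ?_, right_inv := fun _ => rfl }
    { LinearMap.snd D Z' Z with
      invFun := fun w => (0, w), left_inv := fun _ => ?_, right_inv := fun _ => rfl }
    (fun _ => rfl) fun _ => rfl <;> exact Prod.ext (Subsingleton.elim _ _) rfl

/-- Without a right strip, there is nothing to mix. -/
theorem of_subsingleton [Subsingleton Z] (t' : StripMixing) (h : SystemEquiv t a b a' b') :
    SystemEquiv t' a b a' b' := by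
  cases t
  · obtain ⟨P, Q, Y, ha, hb⟩ := h
    have : Subsingleton Z' := Q.symm.toEquiv.subsingleton
    exact of_linearEquiv P Q ha fun w => Subsingleton.elim _ _
  · obtain ⟨P, Q, X, ha, hb⟩ := h
    have hz : ∀ w, b w = 0 := fun w => Subsingleton.elim _ _
    exact of_linearEquiv P Q (fun w => by simp [ha, hz]) hb

/-- Under `intoRight`, the second map matters only on the kernel of the first one. -/
theorem intoRight_of_eqOn_ker {c : W →ₗ[D] Z} (h : ∀ w, a w = 0 → b w = c w) :
    SystemEquiv .intoRight a b a c := by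
  have hk : a.ker ≤ (c - b).ker := fun w hw => by
    simp only [LinearMap.mem_ker, LinearMap.sub_apply] at hw ⊢
    rw [h w hw, sub_self]
  obtain ⟨Y, hY⟩ := LinearMap.exists_extend
    ((a.ker.liftQ (c - b) hk) ∘ₗ (a.quotKerEquivRange.symm : a.range →ₗ[D] W ⧸ a.ker))
  refine ⟨.refl D W, .refl D Z, Y, fun _ => rfl, fun w => ?_⟩
  have h1 := LinearMap.congr_fun hY ⟨a w, w, rfl⟩
  have h2 : a.quotKerEquivRange.symm ⟨a w, w, rfl⟩ = a.ker.mkQ w := by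
    rw [LinearEquiv.symm_apply_eq]; rfl
  simp only [LinearMap.comp_apply, Submodule.subtype_apply, LinearEquiv.coe_coe, h2,
    Submodule.mkQ_apply, Submodule.liftQ_apply, LinearMap.sub_apply] at h1
  simp [h1]

end SystemEquiv

end SystemEquivalence

/-! ### The system of a block matrix -/

namespace BlockMatrix

variable {D : Type*} [DivisionRing D]

/-- The map `x ↦ x A` of row vectors given by `[A|B]`. -/
def leftMap (M : BlockMatrix D) : (Fin M.rows → D) →ₗ[D] (Fin M.rows → D) := M.left.vecMulLinear

/-- The map `x ↦ x B` of row vectors given by `[A|B]`. -/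
def rightMap (M : BlockMatrix D) : (Fin M.rows → D) →ₗ[D] (Fin M.cols → D) := M.right.vecMulLinear

@[simp]
theorem leftMap_apply (M : BlockMatrix D) (x : Fin M.rows → D) : M.leftMap x = x ᵥ* M.left := rfl

@[simp]
theorem rightMap_apply (M : BlockMatrix D) (x : Fin M.rows → D) : M.rightMap x = x ᵥ* M.right := rfl

/-- Juxtaposition of row vectors. -/
def appendEquiv (D : Type*) [DivisionRing D] (m n : ℕ) :
    ((Fin m → D) × (Fin n → D)) ≃ₗ[D] (Fin (m + n) → D) :=
  (LinearEquiv.sumArrowLequivProdArrow (Fin m) (Fin n) D D).symm.trans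
    (LinearEquiv.funCongrLeft D D finSumFinEquiv.symm)

theorem appendEquiv_apply {m n : ℕ} (x : (Fin m → D) × (Fin n → D)) :
    appendEquiv D m n x = Sum.elim x.1 x.2 ∘ finSumFinEquiv.symm := rfl

theorem appendEquiv_vecMul {m n m' n' : ℕ} (A : Matrix (Fin m) (Fin m') D)
    (B : Matrix (Fin n) (Fin n') D) (x : (Fin m → D) × (Fin n → D)) :
    appendEquiv D m n x ᵥ* Matrix.reindex finSumFinEquiv finSumFinEquiv (fromBlocks A 0 0 B) =
      appendEquiv D m' n' (x.1 ᵥ* A, x.2 ᵥ* B) := by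
  rw [appendEquiv_apply, appendEquiv_apply, Matrix.reindex_apply, submatrix_vecMul_equiv]
  simp [vecMul_fromBlocks, Function.comp_assoc]

theorem systemEquiv_blockSum (t : StripMixing) (M N : BlockMatrix D) :
    SystemEquiv t (M.leftMap.prodMap N.leftMap) (M.rightMap.prodMap N.rightMap)
      (M.blockSum N).leftMap (M.blockSum N).rightMap :=
  .of_linearEquiv (appendEquiv D M.rows N.rows) (appendEquiv D M.cols N.cols)
    (fun w => appendEquiv_vecMul M.left N.left w) fun w => appendEquiv_vecMul M.right N.right w

/-- Equivalence of the systems of two block matrices. -/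
def Equivalent (t : StripMixing) (M N : BlockMatrix D) : Prop :=
  SystemEquiv t M.leftMap M.rightMap N.leftMap N.rightMap

namespace Equivalent

variable {t : StripMixing} {M M' N N' : BlockMatrix D} {L L' : List (BlockMatrix D)}

theorem blockSum (h : Equivalent t M M') (h' : Equivalent t N N') :
    Equivalent t (M.blockSum N) (M'.blockSum N') :=
  ((systemEquiv_blockSum t M N).symm.trans (SystemEquiv.prodMap h h')).trans
    (systemEquiv_blockSum t M' N')

theorem blockSum_comm (t : StripMixing) (M N : BlockMatrix D) :
    Equivalent t (M.blockSum N) (N.blockSum M) :=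
  ((systemEquiv_blockSum t M N).symm.trans (.prodMap_comm ..)).trans (systemEquiv_blockSum t N M)

theorem blockSum_assoc (t : StripMixing) (M N R : BlockMatrix D) :
    Equivalent t ((M.blockSum N).blockSum R) (M.blockSum (N.blockSum R)) := by
  have h1 := (systemEquiv_blockSum t (M.blockSum N) R).symm.trans
    ((systemEquiv_blockSum t M N).symm.prodMap (.refl t R.leftMap R.rightMap))
  have h2 := ((SystemEquiv.refl t M.leftMap M.rightMap).prodMap
    (systemEquiv_blockSum t N R)).trans (systemEquiv_blockSum t M (N.blockSum R))
  exact (h1.trans (.prodMap_assoc ..)).trans h2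

theorem empty_blockSum (t : StripMixing) (M : BlockMatrix D) :
    Equivalent t (BlockMatrix.empty.blockSum M) M := by
  have : Subsingleton (Fin (BlockMatrix.empty : BlockMatrix D).rows → D) :=
    inferInstanceAs (Subsingleton (Fin 0 → D))
  have : Subsingleton (Fin (BlockMatrix.empty : BlockMatrix D).cols → D) :=
    inferInstanceAs (Subsingleton (Fin 0 → D))
  exact (systemEquiv_blockSum t _ M).symm.trans (.subsingleton_prodMap ..)

theorem listSum_append (t : StripMixing) (L L' : List (BlockMatrix D)) :
    Equivalent t (listSum (L ++ L')) ((listSum L).blockSum (listSum L')) := by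
  induction L with
  | nil => exact (empty_blockSum t _).symm
  | cons M L ih =>
    exact (blockSum (.refl t M.leftMap M.rightMap) ih).trans (blockSum_assoc t _ _ _).symm

theorem listSum_perm (t : StripMixing) (h : L.Perm L') :
    Equivalent t (listSum L) (listSum L') := by
  induction h with
  | nil => exact .refl t _ _
  | cons M _ ih => exact blockSum (.refl t M.leftMap M.rightMap) ih
  | swap M N L =>
    exact ((blockSum_assoc t N M (listSum L)).symm.trans
      (blockSum (blockSum_comm t N M) (.refl t _ _))).trans (blockSum_assoc t M N (listSum L))
  | trans _ _ ih ih' => exact ih.trans ih'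

end Equivalent

end BlockMatrix

namespace BlockMatrix

variable {D : Type*} [DivisionRing D]

/-! ### Jordan blocks acting on row vectors -/

theorem vecMul_jordan {q : ℕ} (μ : D) (x : Fin q → D) (j : Fin q) :
    (x ᵥ* jordan q μ) j = x j * μ + if h : 0 < (j : ℕ) then x ⟨j - 1, by omega⟩ else 0 := by
  have hsplit : ∀ i : Fin q, x i * jordan q μ i j =
      (if i = j then x i * μ else 0) + if (j : ℕ) = i + 1 then x i else 0 := by
    intro i
    by_cases h : i = j
    · subst h; simp [jordan]
    · by_cases h' : (j : ℕ) = i + 1 <;> simp [jordan, h, h']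
  simp only [vecMul, dotProduct, hsplit, Finset.sum_add_distrib]
  congr 1
  · simp
  · split_ifs with h
    · rw [Finset.sum_eq_single ⟨j - 1, by omega⟩]
      · rw [if_pos]; simp only; omega
      · intro i _ hi
        rw [if_neg]
        intro h'
        exact hi (Fin.ext (by simp only; omega))
      · simp
    · refine Finset.sum_eq_zero fun i _ => if_neg ?_
      omega

theorem vecMul_jordan_zero {q : ℕ} (x : Fin q → D) (j : Fin q) :
    (x ᵥ* jordan q (0 : D)) j = if h : 0 < (j : ℕ) then x ⟨j - 1, by omega⟩ else 0 := by
  simp [vecMul_jordan]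

theorem vecMul_lastColumn {q : ℕ} (x : Fin q → D) (j : Fin 1) :
    (x ᵥ* lastColumn q) j = if h : 0 < q then x ⟨q - 1, by omega⟩ else 0 := by
  simp only [vecMul, dotProduct, lastColumn, of_apply, mul_ite, mul_one, mul_zero]
  split_ifs with h
  · rw [Finset.sum_eq_single ⟨q - 1, by omega⟩]
    · rw [if_pos]; simp only; omega
    · intro i _ hi
      rw [if_neg]
      intro h'
      exact hi (Fin.ext (by simp only; omega))
    · simp
  · refine Finset.sum_eq_zero fun i _ => ?_
    exact absurd i.2 (by omega)

/-- The singular summands: `inl q` stands for `[J_{q+1}(0)|0]` and `inr q` for `[J_q(0)|E_q]`. -/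
def singularSummand (D : Type*) [DivisionRing D] : ℕ ⊕ ℕ → BlockMatrix D
  | .inl q => ofSquare (jordan (q + 1) 0)
  | .inr q => ⟨q, 1, jordan q 0, lastColumn q⟩

theorem isSingularSummand_iff {M : BlockMatrix D} :
    M.IsSingularSummand ↔ ∃ s, M = singularSummand D s := by
  constructor
  · rintro (⟨q, hq, rfl⟩ | ⟨q, rfl⟩)
    · obtain ⟨q, rfl⟩ := Nat.exists_eq_add_of_le' hq
      exact ⟨.inl q, rfl⟩
    · exact ⟨.inr q, rfl⟩
  · rintro ⟨q | q, rfl⟩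
    · exact .inl ⟨q + 1, by omega, rfl⟩
    · exact .inr ⟨q, rfl⟩

theorem forall_isSingularSummand_iff {L : List (BlockMatrix D)} :
    (∀ M ∈ L, M.IsSingularSummand) ↔ ∃ c : List (ℕ ⊕ ℕ), L = c.map (singularSummand D) := by
  constructor
  · intro h
    induction L with
    | nil => exact ⟨[], rfl⟩
    | cons M L ih =>
      obtain ⟨s, hs⟩ := isSingularSummand_iff.1 (h M (by simp))
      obtain ⟨c, hc⟩ := ih fun N hN => h N (by simp [hN])
      exact ⟨s :: c, by simp [hs, hc]⟩
  · rintro ⟨c, rfl⟩ M hM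
    obtain ⟨s, -, rfl⟩ := List.mem_map.1 hM
    exact isSingularSummand_iff.2 ⟨s, rfl⟩

theorem appendEquiv_castAdd {m n : ℕ} (x : (Fin m → D) × (Fin n → D)) (i : Fin m) :
    appendEquiv D m n x (i.castAdd n) = x.1 i := by
  simp [appendEquiv_apply]

theorem appendEquiv_natAdd {m n : ℕ} (x : (Fin m → D) × (Fin n → D)) (i : Fin n) :
    appendEquiv D m n x (i.natAdd m) = x.2 i := by
  simp [appendEquiv_apply]

end BlockMatrix


/-! ### Splitting off a summand -/

section Splitting

variable {D : Type*} [DivisionRing D]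
variable {W : Type*} [AddCommGroup W] [Module D W] {Z : Type*} [AddCommGroup Z] [Module D Z]

/-- A space is the direct sum of a line and a hyperplane not containing it. -/
noncomputable def lineProdKerEquiv (g : Z →ₗ[D] D) (z : Z) (h : g z = 1) :
    ((Fin 1 → D) × g.ker) ≃ₗ[D] Z :=
  LinearEquiv.ofBijective
    (((LinearMap.toSpanSingleton D Z z) ∘ₗ LinearMap.proj 0).coprod g.ker.subtype) <| by
    constructor
    · rw [injective_iff_map_eq_zero]
      rintro ⟨s, y, hy⟩ hs
      simp only [LinearMap.coprod_apply, LinearMap.comp_apply, LinearMap.proj_apply,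
        LinearMap.toSpanSingleton_apply, Submodule.subtype_apply] at hs
      rw [LinearMap.mem_ker] at hy
      have h0 : s 0 = 0 := by simpa [h, hy] using congrArg g hs
      have h1 : y = 0 := by simpa [h0] using hs
      ext i
      · rw [Subsingleton.elim i 0]; exact h0
      · exact h1
    · intro y
      refine ⟨(fun _ => g y, ⟨y - g y • z, by simp [h]⟩), by simp⟩

@[simp]
theorem lineProdKerEquiv_apply (g : Z →ₗ[D] D) (z : Z) (h : g z = 1) (p : (Fin 1 → D) × g.ker) :
    lineProdKerEquiv g z h p = p.1 0 • z + p.2 := rfl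

theorem finrank_ker_lt [FiniteDimensional D Z] {g : Z →ₗ[D] D} {z : Z} (h : g z = 1) :
    Module.finrank D g.ker < Module.finrank D Z :=
  Submodule.finrank_lt fun h' => by
    have : z ∈ g.ker := h' ▸ trivial
    simp [h] at this

/-- If `b` is not surjective, then a zero column, that is, a summand `[J_0(0)|E_0]`, splits off. -/
theorem exists_split_zeroColumn [FiniteDimensional D Z] (t : StripMixing) (a : W →ₗ[D] W)
    (b : W →ₗ[D] Z) (hb : ¬ Function.Surjective b) :
    ∃ (Z₁ : Submodule D Z) (b₁ : W →ₗ[D] Z₁),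
      Module.finrank D Z₁ < Module.finrank D Z ∧
      SystemEquiv t ((singularSummand D (.inr 0)).leftMap.prodMap a)
        ((singularSummand D (.inr 0)).rightMap.prodMap b₁) a b := by
  obtain ⟨z, hz⟩ : ∃ z, z ∉ b.range := by
    by_contra! h
    exact hb fun z => h z
  obtain ⟨g, hg, hgz⟩ := LinearMap.exists_extend_of_notMem (0 : b.range →ₗ[D] D) hz 1
  have hgb : ∀ w, g (b w) = 0 := fun w => by
    simpa using LinearMap.congr_fun hg ⟨b w, w, rfl⟩
  have : Subsingleton (Fin (singularSummand D (.inr 0)).rows → D) :=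
    inferInstanceAs (Subsingleton (Fin 0 → D))
  refine ⟨g.ker, b.codRestrict g.ker hgb, finrank_ker_lt hgz, ?_⟩
  refine .of_linearEquiv
    { LinearMap.snd D (Fin (singularSummand D (.inr 0)).rows → D) W with
      invFun := fun w => (0, w)
      left_inv := fun _ => Prod.ext (Subsingleton.elim _ _) rfl
      right_inv := fun _ => rfl }
    (lineProdKerEquiv g z hgz) (fun _ => rfl) ?_
  rintro ⟨x, w⟩
  rw [Subsingleton.elim x 0]
  have h0 : (singularSummand D (.inr 0)).rightMap 0 = 0 := map_zero _
  change b w = lineProdKerEquiv g z hgz ((singularSummand D (.inr 0)).rightMap 0, _)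
  rw [h0]
  exact (by simp : b w = (0 : D) • z + b w)

variable (a : W →ₗ[D] W) (n : ℕ) (v : W) (f : W →ₗ[D] D)

/-- The map `x ↦ ∑ i, x_i a^i v` for a vector `v` and row vectors `x` of length `n + 1`. -/
def chainMap : (Fin (n + 1) → D) →ₗ[D] W := Fintype.linearCombination D fun i => (a ^ (i : ℕ)) v

/-- The map whose coordinates are the functionals `f (a^(n-i) w)`. -/
def chainDual : W →ₗ[D] (Fin (n + 1) → D) := LinearMap.pi fun i => f ∘ₗ (a ^ (n - (i : ℕ)))

variable {a n v f}

theorem chainMap_apply (x : Fin (n + 1) → D) : chainMap a n v x = ∑ i, x i • (a ^ (i : ℕ)) v := by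
  simp [chainMap, Fintype.linearCombination_apply]

theorem chainDual_apply (w : W) (i : Fin (n + 1)) :
    chainDual a n f w i = f ((a ^ (n - (i : ℕ))) w) :=
  rfl

theorem pow_apply_eq_zero_of_lt (ha : a ^ (n + 1) = 0) {k : ℕ} (hk : n < k) (w : W) :
    (a ^ k) w = 0 := by
  rw [← Nat.sub_add_cancel (Nat.succ_le_of_lt hk), pow_add, Nat.succ_eq_add_one, ha]
  simp

theorem apply_chainMap (ha : a ^ (n + 1) = 0) (x : Fin (n + 1) → D) :
    a (chainMap a n v x) = chainMap a n v (x ᵥ* jordan (n + 1) 0) := by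
  rw [chainMap_apply, chainMap_apply, map_sum, Fin.sum_univ_castSucc, Fin.sum_univ_succ,
    add_comm]
  congr 1
  · simp only [map_smul, ← Module.End.mul_apply, ← pow_succ']
    simp [vecMul_jordan_zero, ha]
  · refine Finset.sum_congr rfl fun i _ => ?_
    simp only [map_smul, ← Module.End.mul_apply, ← pow_succ']
    simp [vecMul_jordan_zero]
    rfl

/-- The composition is triangular with units on the diagonal. -/
theorem chainDual_chainMap_injective (ha : a ^ (n + 1) = 0) (hf : f ((a ^ n) v) = 1) :
    Function.Injective (chainDual a n f ∘ₗ chainMap a n v) := by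
  rw [injective_iff_map_eq_zero]
  intro x hx
  have key : ∀ k (hk : k < n + 1), x ⟨k, hk⟩ = 0 := by
    intro k
    induction k using Nat.strong_induction_on with
    | _ k ih =>
      intro hk
      have h1 := congrFun hx ⟨k, hk⟩
      rw [LinearMap.comp_apply, chainDual_apply, chainMap_apply, map_sum, map_sum,
        Finset.sum_eq_single ⟨k, hk⟩] at h1
      · simp only [map_smul, ← Module.End.mul_apply, ← pow_add] at h1
        rw [Nat.sub_add_cancel (by omega), hf] at h1
        simpa using h1
      · intro j _ hj
        rcases lt_or_gt_of_ne (fun h => hj (Fin.ext h) : (j : ℕ) ≠ k) with h | h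
        · rw [show x j = 0 from ih j h j.2]; simp
        · simp only [map_smul, ← Module.End.mul_apply, ← pow_add]
          rw [pow_apply_eq_zero_of_lt ha (by omega)]; simp
      · simp
  exact funext fun i => key i i.2

/-- A chain `v, a v, …, a^n v` of maximal length spans a direct summand, and a complement is cut
out by the functionals `f (a^i w)`. -/
noncomputable def chainEquiv (ha : a ^ (n + 1) = 0) (hf : f ((a ^ n) v) = 1) :
    ((Fin (n + 1) → D) × (chainDual a n f).ker) ≃ₗ[D] W :=
  LinearEquiv.ofBijective ((chainMap a n v).coprod (chainDual a n f).ker.subtype) <| by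
    have hinj := chainDual_chainMap_injective ha hf
    have hsurj := LinearMap.injective_iff_surjective.1 hinj
    constructor
    · rw [injective_iff_map_eq_zero]
      rintro ⟨x, y, hy⟩ hs
      simp only [LinearMap.coprod_apply, Submodule.subtype_apply] at hs
      rw [LinearMap.mem_ker] at hy
      have h0 : x = 0 := hinj (by simpa [hy] using congrArg (chainDual a n f) hs)
      have h1 : y = 0 := by simpa [h0] using hs
      exact Prod.ext h0 (Subtype.ext h1)
    · intro w
      obtain ⟨x, hx⟩ := hsurj (chainDual a n f w)
      refine ⟨(x, ⟨w - chainMap a n v x, ?_⟩), by simp⟩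
      rw [LinearMap.mem_ker, map_sub, ← hx]
      simp

@[simp]
theorem chainEquiv_apply (ha : a ^ (n + 1) = 0) (hf : f ((a ^ n) v) = 1)
    (p : (Fin (n + 1) → D) × (chainDual a n f).ker) :
    chainEquiv ha hf p = chainMap a n v p.1 + p.2 := rfl

theorem apply_mem_ker_chainDual (ha : a ^ (n + 1) = 0) {w : W} (hw : w ∈ (chainDual a n f).ker) :
    a w ∈ (chainDual a n f).ker := by
  rw [LinearMap.mem_ker] at hw ⊢
  funext i
  rw [chainDual_apply, ← Module.End.mul_apply, ← pow_succ]
  rcases Nat.eq_zero_or_pos (i : ℕ) with h | h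
  · rw [h, Nat.sub_zero, ha]; simp
  · have := congrFun hw ⟨i - 1, by omega⟩
    rw [chainDual_apply, show n - ((⟨i - 1, by omega⟩ : Fin (n + 1)) : ℕ) = n - i + 1 by
      simp only; omega] at this
    exact this

theorem chainMap_of_vecMul_jordan_eq_zero (x : Fin (n + 1) → D)
    (hx : x ᵥ* jordan (n + 1) (0 : D) = 0) :
    chainMap a n v x = x (Fin.last n) • (a ^ n) v := by
  rw [chainMap_apply, Finset.sum_eq_single (Fin.last n)]
  · simp
  · intro i _ hi
    have hlt : (i : ℕ) < n := Fin.val_lt_last hi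
    have := congrFun hx ⟨i + 1, by omega⟩
    rw [vecMul_jordan_zero] at this
    simp only [Nat.zero_lt_succ, dif_pos, Nat.add_sub_cancel, Fin.eta, Pi.zero_apply] at this
    simp [this]
  · simp

variable {b : W →ₗ[D] Z}

/-- For nilpotent `a`, a chain of maximal length splits off. Under `intoRight` the values of `b`
matter on the last vector of the chain only, so it is enough to choose the complement to the chain
such that `b` maps its part in the kernel of `a` to a complement of the value there. -/
theorem exists_split_chain [FiniteDimensional D W] [Nontrivial W] (a : W →ₗ[D] W) (b : W →ₗ[D] Z)
    (ha : IsNilpotent a) :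
    ∃ (s : ℕ ⊕ ℕ) (C : Submodule D W) (Z₁ : Submodule D Z) (a₁ : C →ₗ[D] C) (b₁ : C →ₗ[D] Z₁),
      Module.finrank D C < Module.finrank D W ∧ IsNilpotent a₁ ∧
      SystemEquiv .intoRight ((singularSummand D s).leftMap.prodMap a₁)
        ((singularSummand D s).rightMap.prodMap b₁) a b := by
  obtain ⟨n, ha, hn⟩ : ∃ n, a ^ (n + 1) = 0 ∧ a ^ n ≠ 0 := by
    refine ⟨nilpotencyClass a - 1, ?_, ?_⟩
    · rw [Nat.sub_add_cancel (pos_nilpotencyClass_iff.2 ha)]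
      exact pow_nilpotencyClass ha
    · exact pow_pred_nilpotencyClass ha
  obtain ⟨v, hv⟩ : ∃ v, (a ^ n) v ≠ 0 := by
    by_contra! h
    exact hn (LinearMap.ext h)
  have finish : ∀ f : W →ₗ[D] D, f ((a ^ n) v) = 1 →
      Module.finrank D (chainDual a n f).ker < Module.finrank D W := fun f hf =>
    Submodule.finrank_lt fun h' => by
      have : v ∈ (chainDual a n f).ker := h' ▸ trivial
      have := congrFun (LinearMap.mem_ker.1 this) 0
      simp [chainDual_apply, hf] at this
  have nilp : ∀ f : W →ₗ[D] D,
      IsNilpotent (a.restrict fun _ => apply_mem_ker_chainDual (f := f) ha) := fun f =>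
    ⟨n + 1, by
      ext w
      rw [Module.End.pow_restrict]
      simp [ha]⟩
  by_cases hbv : b ((a ^ n) v) = 0
  · obtain ⟨f, -, hf⟩ := LinearMap.exists_extend_of_notMem (0 : (⊥ : Submodule D W) →ₗ[D] D)
      (v := (a ^ n) v) hv 1
    -- `b` vanishes on the last vector of the chain, and any complement to the chain will do.
    refine ⟨.inl n, (chainDual a n f).ker, ⊤, a.restrict fun _ => apply_mem_ker_chainDual ha,
      Submodule.topEquiv.symm.toLinearMap ∘ₗ b ∘ₗ Submodule.subtype _, finish f hf, nilp f, ?_⟩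
    have : Subsingleton (Fin (singularSummand D (.inl n)).cols → D) :=
      inferInstanceAs (Subsingleton (Fin 0 → D))
    let Q : ((Fin (singularSummand D (.inl n)).cols → D) × (⊤ : Submodule D Z)) ≃ₗ[D] Z :=
      { Submodule.subtype _ ∘ₗ
          LinearMap.snd D (Fin (singularSummand D (.inl n)).cols → D) (⊤ : Submodule D Z) with
        invFun := fun w => (0, ⟨w, trivial⟩)
        left_inv := fun _ => Prod.ext (Subsingleton.elim _ _) rfl
        right_inv := fun _ => rfl }
    refine .trans (.trans (.comp_linearEquiv _ _ _ Q)
      (.intoRight_of_eqOn_ker (c := b ∘ₗ (chainEquiv ha hf).toLinearMap) ?_))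
      (.of_linearEquiv (chainEquiv ha hf) (.refl D Z) ?_ (fun _ => rfl))
    · rintro ⟨x, w⟩ hx
      have hx1 : x ᵥ* jordan (n + 1) (0 : D) = 0 := congrArg Prod.fst hx
      change b w = b (chainEquiv ha hf (x, w))
      rw [chainEquiv_apply, chainMap_of_vecMul_jordan_eq_zero _ hx1]
      simp [hbv]
    · rintro ⟨x, w⟩
      change a (chainEquiv ha hf (x, w)) = chainEquiv ha hf (x ᵥ* jordan (n + 1) (0 : D), _)
      rw [chainEquiv_apply, chainEquiv_apply, map_add, apply_chainMap ha]
      rfl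
  · obtain ⟨g, -, hg⟩ := LinearMap.exists_extend_of_notMem (0 : (⊥ : Submodule D Z) →ₗ[D] D)
      (v := b ((a ^ n) v)) hbv 1
    -- With `f = g ∘ b`, the last coordinate of `chainDual` places `b` of the complement in `ker g`.
    have hf : (g ∘ₗ b) ((a ^ n) v) = 1 := hg
    have hker : ∀ w : (chainDual a n (g ∘ₗ b)).ker, b w ∈ g.ker := fun w => by
      have := congrFun (LinearMap.mem_ker.1 w.2) (Fin.last n)
      simpa [chainDual_apply] using this
    refine ⟨.inr (n + 1), (chainDual a n (g ∘ₗ b)).ker, g.ker,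
      a.restrict fun _ => apply_mem_ker_chainDual ha,
      LinearMap.codRestrict _ (b ∘ₗ Submodule.subtype _) hker, finish _ hf, nilp _, ?_⟩
    refine .trans (.trans (.comp_linearEquiv _ _ _ (lineProdKerEquiv g _ hg))
      (.intoRight_of_eqOn_ker (c := b ∘ₗ (chainEquiv ha hf).toLinearMap) ?_))
      (.of_linearEquiv (chainEquiv ha hf) (.refl D Z) ?_ (fun _ => rfl))
    · rintro ⟨x, w⟩ hx
      have hx1 : x ᵥ* jordan (n + 1) (0 : D) = 0 := congrArg Prod.fst hx
      change lineProdKerEquiv g _ hg (x ᵥ* lastColumn (n + 1), _) = b (chainEquiv ha hf (x, w))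
      rw [chainEquiv_apply, chainMap_of_vecMul_jordan_eq_zero _ hx1, lineProdKerEquiv_apply]
      simp [vecMul_lastColumn, Fin.last]
      rfl
    · rintro ⟨x, w⟩
      change a (chainEquiv ha hf (x, w)) = chainEquiv ha hf (x ᵥ* jordan (n + 1) (0 : D), _)
      rw [chainEquiv_apply, chainEquiv_apply, map_add, apply_chainMap ha]
      rfl

end Splitting

/-! ### Existence of decompositions -/

section Fitting

variable {D : Type*} [DivisionRing D]
variable {W : Type*} [AddCommGroup W] [Module D W] {Z : Type*} [AddCommGroup Z] [Module D Z]

/-- A nilpotent system is equivalent, under `intoRight`, to a sum of singular summands. -/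
theorem exists_singularSummands_of_isNilpotent [FiniteDimensional D W] [FiniteDimensional D Z]
    (a : W →ₗ[D] W) (b : W →ₗ[D] Z) (ha : IsNilpotent a) :
    ∃ c : List (ℕ ⊕ ℕ), SystemEquiv .intoRight (listSum (c.map (singularSummand D))).leftMap
      (listSum (c.map (singularSummand D))).rightMap a b := by
  induction hN : Module.finrank D W + Module.finrank D Z using Nat.strong_induction_on
    generalizing W Z with
  | _ N ih =>
  have step : ∀ (s : ℕ ⊕ ℕ) (C : Submodule D W) (Z₁ : Submodule D Z) (a₁ : C →ₗ[D] C)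
      (b₁ : C →ₗ[D] Z₁), Module.finrank D C + Module.finrank D Z₁ < N → IsNilpotent a₁ →
      SystemEquiv .intoRight ((singularSummand D s).leftMap.prodMap a₁)
        ((singularSummand D s).rightMap.prodMap b₁) a b →
      ∃ c : List (ℕ ⊕ ℕ), SystemEquiv .intoRight (listSum (c.map (singularSummand D))).leftMap
        (listSum (c.map (singularSummand D))).rightMap a b := by
    intro s C Z₁ a₁ b₁ hlt ha₁ h
    obtain ⟨c, hc⟩ := ih _ hlt a₁ b₁ ha₁ rfl
    exact ⟨s :: c,
      ((systemEquiv_blockSum _ _ _).symm.trans ((SystemEquiv.refl ..).prodMap hc)).trans h⟩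
  rcases subsingleton_or_nontrivial W with hW | hW
  · by_cases hb : Function.Surjective b
    · have : Subsingleton Z := hb.subsingleton
      exact ⟨[], .of_linearEquiv (LinearEquiv.ofSubsingleton (Fin 0 → D) W)
        (LinearEquiv.ofSubsingleton (Fin 0 → D) Z)
        (fun _ => Subsingleton.elim _ _) (fun _ => Subsingleton.elim _ _)⟩
    · obtain ⟨Z₁, b₁, hlt, h⟩ := exists_split_zeroColumn .intoRight a b hb
      have ht : SystemEquiv .intoRight a b₁ (Submodule.topEquiv.symm.toLinearMap ∘ₗ a ∘ₗ
          Submodule.topEquiv.toLinearMap) (b₁ ∘ₗ Submodule.topEquiv.toLinearMap) :=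
        .of_linearEquiv Submodule.topEquiv.symm (.refl D _) (fun _ => rfl) fun _ => rfl
      refine step (.inr 0) ⊤ Z₁ _ _ ?_ ?_ (((SystemEquiv.refl ..).prodMap ht.symm).trans h)
      · rw [finrank_top]; omega
      · exact ⟨1, LinearMap.ext fun _ => Subsingleton.elim _ _⟩
  · obtain ⟨s, C, Z₁, a₁, b₁, hlt, ha₁, h⟩ := exists_split_chain a b ha
    have := Submodule.finrank_le Z₁
    exact step s C Z₁ a₁ b₁ (by omega) ha₁ h

/-- Fitting's decomposition; under `intoRight`, the part of the second map on the regular summand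
can be made zero. -/
theorem exists_fitting [FiniteDimensional D W] (a : W →ₗ[D] W) (b : W →ₗ[D] Z) :
    ∃ (R N : Submodule D W) (r : R →ₗ[D] R) (a₁ : N →ₗ[D] N) (b₁ : N →ₗ[D] Z),
      Function.Injective r ∧ IsNilpotent a₁ ∧
      SystemEquiv .intoRight (r.prodMap a₁)
        ((0 : R →ₗ[D] (Fin 0 → D)).prodMap b₁) a b := by
  obtain ⟨k, hk⟩ := Filter.eventually_atTop.1 a.eventually_isCompl_ker_pow_range_pow
  have hc := (hk (k + 1) (by omega)).symm
  have hR : ∀ w ∈ (a ^ (k + 1)).range, a w ∈ (a ^ (k + 1)).range := by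
    rintro _ ⟨w, rfl⟩
    exact ⟨a w, by rw [← Module.End.mul_apply, ← Module.End.mul_apply, pow_mul_comm']⟩
  have hN : ∀ w ∈ (a ^ (k + 1)).ker, a w ∈ (a ^ (k + 1)).ker := by
    intro w hw
    rw [LinearMap.mem_ker] at hw ⊢
    rw [← Module.End.mul_apply, pow_mul_comm', Module.End.mul_apply, hw, map_zero]
  have hinj : ∀ w ∈ (a ^ (k + 1)).range, a w = 0 → w = 0 := by
    intro w hw h0
    refine Submodule.disjoint_def.1 hc.disjoint w hw ?_
    rw [LinearMap.mem_ker, pow_succ]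
    simp [h0]
  have hr : Function.Injective (a.restrict hR) := by
    rw [injective_iff_map_eq_zero]
    exact fun w hw => Subtype.ext (hinj w w.2 (congrArg Subtype.val hw))
  let P := Submodule.prodEquivOfIsCompl _ _ hc
  let Q : ((Fin 0 → D) × Z) ≃ₗ[D] Z :=
    { LinearMap.snd D (Fin 0 → D) Z with
      invFun := fun w => (0, w)
      left_inv := fun _ => Prod.ext (Subsingleton.elim _ _) rfl
      right_inv := fun _ => rfl }
  refine ⟨(a ^ (k + 1)).range, (a ^ (k + 1)).ker, a.restrict hR, a.restrict hN,
    b ∘ₗ Submodule.subtype _, hr, ⟨k + 1, ?_⟩, ?_⟩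
  · ext w
    rw [Module.End.pow_restrict]
    simp
  · refine ((SystemEquiv.comp_linearEquiv _ _ _ Q).trans
      (.intoRight_of_eqOn_ker (c := b ∘ₗ P.toLinearMap) ?_)).trans
      (.of_linearEquiv P (.refl D Z) ?_ fun _ => rfl)
    · rintro ⟨x, w⟩ hx
      have hx1 : x = 0 := hr ((congrArg Prod.fst hx).trans (map_zero _).symm)
      subst hx1
      change b w = b (P (0, w))
      simp [P]
    · rintro ⟨x, w⟩
      simp [P]

/-- Every system is equivalent, under `intoRight`, to the sum of a regular summand and of singular
summands. -/
theorem exists_decomposition_intoRight [FiniteDimensional D W] [FiniteDimensional D Z]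
    (a : W →ₗ[D] W) (b : W →ₗ[D] Z) :
    ∃ (p : ℕ) (K : Matrix (Fin p) (Fin p) D) (c : List (ℕ ⊕ ℕ)), IsUnit K ∧
      SystemEquiv .intoRight (listSum (ofSquare K :: c.map (singularSummand D))).leftMap
        (listSum (ofSquare K :: c.map (singularSummand D))).rightMap a b := by
  obtain ⟨R, N, r, a₁, b₁, hr, ha₁, h⟩ := exists_fitting a b
  obtain ⟨c, hc⟩ := exists_singularSummands_of_isNilpotent a₁ b₁ ha₁
  let e : R ≃ₗ[D] (Fin (Module.finrank D R) → D) := (Module.finBasis D R).equivFun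
  let r' : R ≃ₗ[D] R := LinearEquiv.ofBijective r ⟨hr, LinearMap.injective_iff_surjective.1 hr⟩
  let f : (Fin (Module.finrank D R) → D) ≃ₗ[D] (Fin (Module.finrank D R) → D) :=
    e.symm.trans (r'.trans e)
  have hmul : ∀ g h : (Fin (Module.finrank D R) → D) ≃ₗ[D] (Fin (Module.finrank D R) → D),
      g.trans h = .refl D _ →
      LinearMap.toMatrixRight' g.toLinearMap * LinearMap.toMatrixRight' h.toLinearMap = 1 := by
    intro g h hgh
    rw [← LinearMap.toMatrixRight'_comp, ← LinearMap.toMatrixRight'_id]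
    exact congrArg _ (congrArg LinearEquiv.toLinearMap hgh)
  have hK : SystemEquiv .intoRight (ofSquare (LinearMap.toMatrixRight' f.toLinearMap)).leftMap
      (ofSquare (LinearMap.toMatrixRight' f.toLinearMap)).rightMap r
      (0 : R →ₗ[D] (Fin 0 → D)) := by
    have hf : ∀ w, r (e.symm w) =
        e.symm (Matrix.toLinearMapRight' (LinearMap.toMatrixRight' f.toLinearMap) w) := fun w => by
      rw [LinearEquiv.symm_apply_apply]
      exact (e.symm_apply_apply _).symm
    exact .of_linearEquiv e.symm (.refl D _) hf fun _ => Subsingleton.elim _ _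
  refine ⟨_, LinearMap.toMatrixRight' f.toLinearMap, c, ?_,
    ((systemEquiv_blockSum _ _ _).symm.trans (hK.prodMap hc)).trans h⟩
  exact ⟨⟨_, LinearMap.toMatrixRight' f.symm.toLinearMap, hmul _ _ (by simp),
    hmul _ _ (by simp)⟩, rfl⟩

end Fitting

/-! ### Prolongation of systems -/

section Prolongation

variable {D : Type*} [DivisionRing D]
variable {W : Type*} [AddCommGroup W] [Module D W] {Z : Type*} [AddCommGroup Z] [Module D Z]
variable {W' : Type*} [AddCommGroup W'] [Module D W'] {Z' : Type*} [AddCommGroup Z'] [Module D Z']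

/-- The first map of the prolongation of a system `(a, b)`, which makes the chains that end in `Z`
longer by one vector: it is the system on `W × Z` that consists of `(w, z) ↦ (a w, b w)` and of the
projection to `Z`. -/
def prolong (a : W →ₗ[D] W) (b : W →ₗ[D] Z) : W × Z →ₗ[D] W × Z :=
  a.prod b ∘ₗ LinearMap.fst D W Z

theorem prolong_apply (a : W →ₗ[D] W) (b : W →ₗ[D] Z) (w : W × Z) :
    prolong a b w = (a w.1, b w.1) := rfl

/-- Under `intoLeft`, prolongation respects equivalence, by way of the map
`(w, z) ↦ (P w + X z, Q z)` on `W × Z`. -/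
theorem SystemEquiv.prolong {a : W →ₗ[D] W} {b : W →ₗ[D] Z} {a' : W' →ₗ[D] W'} {b' : W' →ₗ[D] Z'}
    (h : SystemEquiv .intoLeft a b a' b') :
    SystemEquiv .intoLeft (prolong a b) (LinearMap.snd D W Z) (_root_.prolong a' b')
      (LinearMap.snd D W' Z') := by
  obtain ⟨P, Q, X, ha, hb⟩ := h
  refine ⟨
    { P.toLinearMap.prodMap Q.toLinearMap + (X ∘ₗ LinearMap.snd D W Z).prod 0 with
      invFun := fun w => (P.symm (w.1 - X (Q.symm w.2)), Q.symm w.2)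
      left_inv := fun _ => by simp
      right_inv := fun _ => by simp }, Q, (a' ∘ₗ X).prod (b' ∘ₗ X), fun w => ?_, fun w => ?_⟩
  · change _root_.prolong a' b' (P w.1 + X w.2, Q w.2 + 0) =
      (P (a w.1) + X (b w.1), Q (b w.1) + 0) + (a' (X w.2), b' (X w.2))
    simp [prolong_apply, ha, hb]
  · change Q w.2 + 0 = Q w.2
    simp

/-- If `b` is surjective, then `(a, b)` is the prolongation of a system on the kernel of `b`. -/
theorem systemEquiv_prolong_of_surjective (a : W →ₗ[D] W) (b : W →ₗ[D] Z)
    (hb : Function.Surjective b) :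
    ∃ (a₁ : b.ker →ₗ[D] b.ker) (b₁ : b.ker →ₗ[D] Z),
      SystemEquiv .intoLeft (prolong a₁ b₁) (LinearMap.snd D b.ker Z) a b := by
  obtain ⟨s, hs⟩ := b.exists_rightInverse_of_surjective (LinearMap.range_eq_top.2 hb)
  have hs' : ∀ z, b (s z) = z := LinearMap.congr_fun hs
  have hmem : ∀ w, ((LinearMap.id : W →ₗ[D] W) - s ∘ₗ b) w ∈ b.ker := fun w => by simp [hs']
  refine ⟨LinearMap.codRestrict b.ker (LinearMap.id - s ∘ₗ b) hmem ∘ₗ a ∘ₗ Submodule.subtype _,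
    b ∘ₗ a ∘ₗ Submodule.subtype _,
    { b.ker.subtype.coprod s with
      invFun := fun w => (⟨_, hmem w⟩, b w)
      left_inv := fun w => by
        have : b w.1 = 0 := w.1.2
        ext <;> simp [hs', this]
      right_inv := fun w => by simp },
    .refl D Z, a ∘ₗ s, fun w => ?_, fun w => ?_⟩
  · change a (w.1 + s w.2) = (a w.1 - s (b (a w.1))) + s (b (a w.1)) + a (s w.2)
    simp
  · change b (w.1 + s w.2) = w.2
    have : b w.1 = 0 := w.1.2
    simp [hs', this]

/-- The prolongation of the system of `M` is the system of `M'`. -/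
def IsProlongation (M M' : BlockMatrix D) : Prop :=
  SystemEquiv .intoLeft (prolong M.leftMap M.rightMap) (LinearMap.snd D _ _) M'.leftMap M'.rightMap

theorem IsProlongation.blockSum {M M' N N' : BlockMatrix D} (h : IsProlongation M M')
    (h' : IsProlongation N N') : IsProlongation (M.blockSum N) (M'.blockSum N') := by
  refine ((systemEquiv_blockSum .intoLeft M N).symm.prolong.trans ?_).trans
    ((SystemEquiv.prodMap h h').trans (systemEquiv_blockSum .intoLeft M' N'))
  exact .of_linearEquiv (LinearEquiv.prodProdProdComm D _ _ _ _) (.refl D _) (fun _ => rfl)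
    fun _ => rfl

theorem isProlongation_of_cols_eq_zero {M : BlockMatrix D} (h : M.cols = 0) :
    IsProlongation M M := by
  have : IsEmpty (Fin M.cols) := by rw [h]; infer_instance
  exact .of_linearEquiv
    { LinearMap.fst D (Fin M.rows → D) (Fin M.cols → D) with
      invFun := fun w => (w, 0)
      left_inv := fun _ => Prod.ext rfl (Subsingleton.elim _ _)
      right_inv := fun _ => rfl } (.refl D _) (fun _ => rfl) fun _ => Subsingleton.elim _ _

theorem appendEquiv_vecMul_jordan (q : ℕ) (w : (Fin q → D) × (Fin 1 → D)) :
    appendEquiv D q 1 w ᵥ* jordan (q + 1) (0 : D) =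
      appendEquiv D q 1 (w.1 ᵥ* jordan q (0 : D), w.1 ᵥ* lastColumn q) := by
  funext j
  rw [vecMul_jordan_zero]
  refine Fin.addCases (fun i => ?_) (fun i => ?_) j
  · rw [appendEquiv_castAdd]
    simp only
    rw [vecMul_jordan_zero]
    by_cases h : 0 < (i : ℕ)
    · rw [dif_pos h, dif_pos (by simpa using h), ← appendEquiv_castAdd w]
      rfl
    · rw [dif_neg h, dif_neg (by simpa using h)]
  · rw [appendEquiv_natAdd]
    simp only
    rw [vecMul_lastColumn]
    by_cases h : 0 < q
    · rw [dif_pos h, dif_pos (by simp; omega), ← appendEquiv_castAdd w]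
      exact congrArg (appendEquiv D q 1 w) (Fin.ext (by simp))
    · rw [dif_neg h, dif_neg (by simp; omega)]

theorem appendEquiv_vecMul_lastColumn (q : ℕ) (w : (Fin q → D) × (Fin 1 → D)) :
    appendEquiv D q 1 w ᵥ* lastColumn (q + 1) = w.2 := by
  funext j
  rw [vecMul_lastColumn, dif_pos (by omega), ← appendEquiv_natAdd w]
  rw [Subsingleton.elim j 0]
  rfl

/-- Prolongation turns `[J_q(0)|E_q]` into `[J_{q+1}(0)|E_{q+1}]`. -/
theorem isProlongation_singularSummand_inr (q : ℕ) :
    IsProlongation (singularSummand D (.inr q)) (singularSummand D (.inr (q + 1))) :=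
  .of_linearEquiv (appendEquiv D q 1) (.refl D _) (appendEquiv_vecMul_jordan q)
    (appendEquiv_vecMul_lastColumn q)

theorem exists_isProlongation (c : List (ℕ ⊕ ℕ)) :
    ∃ c' : List (ℕ ⊕ ℕ), IsProlongation (listSum (c.map (singularSummand D)))
      (listSum (c'.map (singularSummand D))) := by
  induction c with
  | nil => exact ⟨[], isProlongation_of_cols_eq_zero rfl⟩
  | cons s c ih =>
    obtain ⟨c', hc'⟩ := ih
    rcases s with q | q
    · exact ⟨.inl q :: c', (isProlongation_of_cols_eq_zero rfl).blockSum hc'⟩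
    · exact ⟨.inr (q + 1) :: c', (isProlongation_singularSummand_inr q).blockSum hc'⟩

/-- Every system is equivalent, under `intoLeft`, to the sum of a regular summand and of singular
summands. -/
theorem exists_decomposition_intoLeft [FiniteDimensional D W] [FiniteDimensional D Z]
    (a : W →ₗ[D] W) (b : W →ₗ[D] Z) :
    ∃ (p : ℕ) (K : Matrix (Fin p) (Fin p) D) (c : List (ℕ ⊕ ℕ)), IsUnit K ∧
      SystemEquiv .intoLeft (listSum (ofSquare K :: c.map (singularSummand D))).leftMap
        (listSum (ofSquare K :: c.map (singularSummand D))).rightMap a b := by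
  induction hN : Module.finrank D W + Module.finrank D Z using Nat.strong_induction_on
    generalizing W Z with
  | _ N ih =>
  by_cases hb : Function.Surjective b
  · rcases subsingleton_or_nontrivial Z with hZ | hZ
    · obtain ⟨p, K, c, hK, h⟩ := exists_decomposition_intoRight a b
      exact ⟨p, K, c, hK, (SystemEquiv.of_subsingleton _ h.symm).symm⟩
    · obtain ⟨a₁, b₁, h⟩ := systemEquiv_prolong_of_surjective a b hb
      have h1 := b.finrank_range_add_finrank_ker
      rw [LinearMap.range_eq_top.2 hb, finrank_top] at h1
      have h2 : 0 < Module.finrank D Z := Module.finrank_pos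
      obtain ⟨p, K, c, hK, hc⟩ := ih _ (by omega) a₁ b₁ rfl
      obtain ⟨c', hc'⟩ := exists_isProlongation (D := D) c
      exact ⟨p, K, c', hK, (((isProlongation_of_cols_eq_zero (M := ofSquare K) rfl).blockSum
        hc').symm.trans hc.prolong).trans h⟩
  · obtain ⟨Z₁, b₁, hlt, h⟩ := exists_split_zeroColumn .intoLeft a b hb
    obtain ⟨p, K, c, hK, hc⟩ := ih _ (by omega) a b₁ rfl
    refine ⟨p, K, .inr 0 :: c, hK, ?_⟩
    have hsw : Equivalent .intoLeft
        (listSum (ofSquare K :: singularSummand D (.inr 0) :: c.map (singularSummand D)))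
        (listSum (singularSummand D (.inr 0) :: ofSquare K :: c.map (singularSummand D))) :=
      .listSum_perm _ (List.Perm.swap ..)
    exact (hsw.trans ((systemEquiv_blockSum _ _ _).symm.trans
      ((SystemEquiv.refl ..).prodMap hc))).trans h

/-- Every system is equivalent to the sum of a regular summand and of singular summands. -/
theorem exists_decomposition [FiniteDimensional D W] [FiniteDimensional D Z] (t : StripMixing)
    (a : W →ₗ[D] W) (b : W →ₗ[D] Z) :
    ∃ (p : ℕ) (K : Matrix (Fin p) (Fin p) D) (c : List (ℕ ⊕ ℕ)), IsUnit K ∧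
      SystemEquiv t (listSum (ofSquare K :: c.map (singularSummand D))).leftMap
        (listSum (ofSquare K :: c.map (singularSummand D))).rightMap a b := by
  cases t
  · exact exists_decomposition_intoRight a b
  · exact exists_decomposition_intoLeft a b

end Prolongation

/-! ### Uniqueness of the regular summand -/

section RegularPart

variable {D : Type*} [DivisionRing D]
variable {W : Type*} [AddCommGroup W] [Module D W] {Z : Type*} [AddCommGroup Z] [Module D Z]
variable {W' : Type*} [AddCommGroup W'] [Module D W'] {Z' : Type*} [AddCommGroup Z'] [Module D Z']

theorem SystemEquiv.exists_linearEquiv {t : StripMixing} {a : W →ₗ[D] W} {b : W →ₗ[D] Z}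
    {a' : W' →ₗ[D] W'} {b' : W' →ₗ[D] Z'} (h : SystemEquiv t a b a' b') :
    ∃ P : W ≃ₗ[D] W', (∀ w, b w = 0 → a' (P w) = P (a w)) ∧
      ∀ w, b' w = 0 → a (P.symm w) = P.symm (a' w) := by
  cases t
  · obtain ⟨P, Q, Y, ha, -⟩ := h
    refine ⟨P, fun w _ => ha w, fun w _ => P.injective ?_⟩
    rw [← ha, P.apply_symm_apply, P.apply_symm_apply]
  · obtain ⟨P, Q, X, ha, hb⟩ := h
    refine ⟨P, fun w hw => by rw [ha, hw, map_zero, add_zero], fun w hw => P.injective ?_⟩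
    have h0 : b (P.symm w) = 0 := by
      apply Q.injective
      rw [← hb, P.apply_symm_apply, hw, map_zero]
    have h1 := ha (P.symm w)
    rw [h0, map_zero, add_zero] at h1
    rw [← h1, P.apply_symm_apply, P.apply_symm_apply]

/-- A surjective and a nilpotent endomorphism have no nonzero intertwiner. -/
theorem intertwiner_eq_zero {r : W →ₗ[D] W} {n : W' →ₗ[D] W'} (hr : Function.Surjective r)
    (hn : IsNilpotent n) (f : W →ₗ[D] W') (h : ∀ w, n (f w) = f (r w)) : f = 0 := by
  obtain ⟨k, hk⟩ := hn
  have key : ∀ i w, f ((r ^ i) w) = (n ^ i) (f w) := by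
    intro i
    induction i with
    | zero => simp
    | succ i ih => intro w; rw [pow_succ, Module.End.mul_apply, ih, ← h, pow_succ]; rfl
  ext w
  obtain ⟨y, rfl⟩ : ∃ y, (r ^ k) y = w := by
    rw [Module.End.coe_pow]
    exact hr.iterate k w
  rw [key, hk]
  rfl

/-- The regular summands of equivalent systems are similar: an equivalence of systems maps one to
the other because its component in the nilpotent part is an intertwiner. -/
theorem exists_linearEquiv_regular {R N R' N' Z₀ Z₁ Z₀' Z₁' : Type*}
    [AddCommGroup R] [Module D R] [AddCommGroup N] [Module D N] [AddCommGroup R'] [Module D R']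
    [AddCommGroup N'] [Module D N'] [AddCommGroup Z₀] [Module D Z₀] [AddCommGroup Z₁] [Module D Z₁]
    [AddCommGroup Z₀'] [Module D Z₀'] [AddCommGroup Z₁'] [Module D Z₁'] {t : StripMixing}
    {r : R →ₗ[D] R} {r' : R' →ₗ[D] R'} {n : N →ₗ[D] N} {n' : N' →ₗ[D] N'} {b₀ : R →ₗ[D] Z₀}
    {b₀' : R' →ₗ[D] Z₀'} {b : N →ₗ[D] Z₁} {b' : N' →ₗ[D] Z₁'} (hr : Function.Surjective r)
    (hr' : Function.Surjective r') (hn : IsNilpotent n) (hn' : IsNilpotent n') (hb : b₀ = 0)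
    (hb' : b₀' = 0)
    (h : SystemEquiv t (r.prodMap n) (b₀.prodMap b) (r'.prodMap n') (b₀'.prodMap b')) :
    ∃ e : R ≃ₗ[D] R', ∀ x, r' (e x) = e (r x) := by
  obtain ⟨P, h1, h2⟩ := h.exists_linearEquiv
  subst hb hb'
  have k1 : ∀ x, r'.prodMap n' (P (x, 0)) = P (r x, 0) := fun x => by
    simpa using h1 (x, 0) (by simp)
  have k2 : ∀ x, r.prodMap n (P.symm (x, 0)) = P.symm (r' x, 0) := fun x => by
    simpa using h2 (x, 0) (by simp)
  have z1 : ∀ x, (P (x, 0)).2 = 0 := fun x => LinearMap.congr_fun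
    (intertwiner_eq_zero hr hn' (LinearMap.snd D R' N' ∘ₗ P.toLinearMap ∘ₗ LinearMap.inl D R N)
      fun w => congrArg Prod.snd (k1 w)) x
  have z2 : ∀ x, (P.symm (x, 0)).2 = 0 := fun x => LinearMap.congr_fun
    (intertwiner_eq_zero hr' hn (LinearMap.snd D R N ∘ₗ P.symm.toLinearMap ∘ₗ LinearMap.inl D R' N')
      fun w => congrArg Prod.snd (k2 w)) x
  refine ⟨
    { LinearMap.fst D R' N' ∘ₗ P.toLinearMap ∘ₗ LinearMap.inl D R N with
      invFun := fun x => (P.symm (x, 0)).1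
      left_inv := fun x => ?_
      right_inv := fun x => ?_ }, fun x => congrArg Prod.fst (k1 x)⟩
  · change (P.symm ((P (x, 0)).1, 0)).1 = x
    rw [show ((P (x, 0)).1, (0 : N')) = P (x, 0) from Prod.ext rfl (z1 x).symm,
      P.symm_apply_apply]
  · change (P ((P.symm (x, 0)).1, 0)).1 = x
    rw [show ((P.symm (x, 0)).1, (0 : N)) = P.symm (x, 0) from Prod.ext rfl (z2 x).symm,
      P.apply_symm_apply]

section MatrixOfLinearMap

variable {ι κ : Type*}

theorem exists_matrix_of_linearEquiv [Fintype ι] [DecidableEq ι] [Fintype κ] [DecidableEq κ]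
    (e : (ι → D) ≃ₗ[D] (κ → D)) :
    ∃ (P : Matrix ι κ D) (P' : Matrix κ ι D), P * P' = 1 ∧ P' * P = 1 ∧ ∀ x, e x = x ᵥ* P := by
  refine ⟨LinearMap.toMatrixRight' e.toLinearMap, LinearMap.toMatrixRight' e.symm.toLinearMap,
    ?_, ?_, fun x => ?_⟩
  · rw [← LinearMap.toMatrixRight'_comp, ← LinearMap.toMatrixRight'_id]
    congr 1
    ext1 x; simp
  · rw [← LinearMap.toMatrixRight'_comp, ← LinearMap.toMatrixRight'_id]
    congr 1
    ext1 x; simp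
  · exact (LinearMap.congr_fun (LinearMap.toMatrixRight'.symm_apply_apply e.toLinearMap) x).symm

theorem exists_matrix_of_linearMap [Fintype ι] [DecidableEq ι] (f : (ι → D) →ₗ[D] (κ → D)) :
    ∃ P : Matrix ι κ D, ∀ x, f x = x ᵥ* P :=
  ⟨LinearMap.toMatrixRight' f, fun x =>
    (LinearMap.congr_fun (LinearMap.toMatrixRight'.symm_apply_apply f) x).symm⟩

theorem eq_of_vecMul_eq [Fintype ι] [DecidableEq ι] {A B : Matrix ι κ D}
    (h : ∀ x, x ᵥ* A = x ᵥ* B) : A = B := by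
  apply Matrix.toLinearMapRight'.injective
  exact LinearMap.ext h

end MatrixOfLinearMap

theorem similarMatrices_of_linearEquiv {p p' : ℕ} {K : Matrix (Fin p) (Fin p) D}
    {K' : Matrix (Fin p') (Fin p') D} (e : (Fin p → D) ≃ₗ[D] (Fin p' → D))
    (he : ∀ x, e x ᵥ* K' = e (x ᵥ* K)) : SimilarMatrices K K' := by
  obtain ⟨S, T, hS, hT, hx⟩ := exists_matrix_of_linearEquiv e
  refine ⟨by simpa using e.finrank_eq, S, T, hS, hT, ?_⟩
  have hK : S * K' = K * S := eq_of_vecMul_eq fun x => by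
    rw [← vecMul_vecMul, ← vecMul_vecMul, ← hx, ← hx, he]
  rw [Matrix.mul_assoc, ← hK, ← Matrix.mul_assoc, hT, Matrix.one_mul]

theorem isNilpotent_prodMap {n : W →ₗ[D] W} {n' : W' →ₗ[D] W'} (h : IsNilpotent n)
    (h' : IsNilpotent n') : IsNilpotent (n.prodMap n') := by
  obtain ⟨k, hk⟩ := h
  obtain ⟨l, hl⟩ := h'
  have key : ∀ i w, ((n.prodMap n') ^ i) w = ((n ^ i) w.1, (n' ^ i) w.2) := by
    intro i
    induction i with
    | zero => intro w; rfl
    | succ i ih => intro w; rw [pow_succ', Module.End.mul_apply, ih, pow_succ', pow_succ']; rfl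
  refine ⟨k + l, LinearMap.ext fun w => ?_⟩
  rw [key, pow_add, hk, pow_add, hl]
  simp

theorem isNilpotent_of_linearEquiv {n : W →ₗ[D] W} {n' : W' →ₗ[D] W'} (P : W ≃ₗ[D] W')
    (h : ∀ w, n' (P w) = P (n w)) (hn : IsNilpotent n) : IsNilpotent n' := by
  obtain ⟨k, hk⟩ := hn
  have key : ∀ i w, (n' ^ i) (P w) = P ((n ^ i) w) := by
    intro i
    induction i with
    | zero => intro w; rfl
    | succ i ih => intro w; rw [pow_succ', Module.End.mul_apply, ih, h, pow_succ']; rfl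
  refine ⟨k, LinearMap.ext fun w => ?_⟩
  rw [← P.apply_symm_apply w, key, hk]
  simp

theorem isNilpotent_leftMap_singularSummand (s : ℕ ⊕ ℕ) :
    IsNilpotent (singularSummand D s).leftMap := by
  have key : ∀ q : ℕ, IsNilpotent (jordan q (0 : D)).vecMulLinear := by
    intro q
    have h : ∀ (k : ℕ) (x : Fin q → D) (j : Fin q), (j : ℕ) < k →
        ((jordan q (0 : D)).vecMulLinear ^ k) x j = 0 := by
      intro k
      induction k with
      | zero => intro x j hj; omega
      | succ k ih =>
        intro x j hj
        rw [pow_succ', Module.End.mul_apply, vecMulLinear_apply, vecMul_jordan_zero]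
        split_ifs with h0
        · exact ih x _ (by simp only; omega)
        · rfl
    exact ⟨q, LinearMap.ext fun x => funext fun j => h q x j j.2⟩
  rcases s with q | q
  · exact key (q + 1)
  · exact key q

theorem isNilpotent_leftMap_listSum (c : List (ℕ ⊕ ℕ)) :
    IsNilpotent (listSum (c.map (singularSummand D))).leftMap := by
  induction c with
  | nil => exact ⟨1, LinearMap.ext fun _ => funext fun i => i.elim0⟩
  | cons s c ih =>
    exact isNilpotent_of_linearEquiv (appendEquiv D _ _)
      (n := (singularSummand D s).leftMap.prodMap (listSum (c.map (singularSummand D))).leftMap)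
      (n' := ((singularSummand D s).blockSum (listSum (c.map (singularSummand D)))).leftMap)
      (fun w => appendEquiv_vecMul (singularSummand D s).left
        (listSum (c.map (singularSummand D))).left w)
      (isNilpotent_prodMap (isNilpotent_leftMap_singularSummand s) ih)

theorem vecMul_bijective_of_isUnit {p : ℕ} {K : Matrix (Fin p) (Fin p) D} (hK : IsUnit K) :
    Function.Bijective K.vecMulLinear := by
  obtain ⟨⟨K, K', h, h'⟩, rfl⟩ := hK
  refine Function.bijective_iff_has_inverse.2 ⟨K'.vecMulLinear, fun x => ?_, fun x => ?_⟩
  · simp [h]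
  · simp [h']

/-- In the decomposition of a block matrix, the regular summand is unique up to similarity. -/
theorem similarMatrices_of_equivalent {t : StripMixing} {p p' : ℕ} {K : Matrix (Fin p) (Fin p) D}
    {K' : Matrix (Fin p') (Fin p') D} {c c' : List (ℕ ⊕ ℕ)} (hK : IsUnit K) (hK' : IsUnit K')
    (h : Equivalent t (listSum (ofSquare K :: c.map (singularSummand D)))
      (listSum (ofSquare K' :: c'.map (singularSummand D)))) : SimilarMatrices K K' := by
  obtain ⟨e, he⟩ := exists_linearEquiv_regular (vecMul_bijective_of_isUnit hK).2
    (vecMul_bijective_of_isUnit hK').2 (isNilpotent_leftMap_listSum c)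
    (isNilpotent_leftMap_listSum c') (LinearMap.ext fun _ => Subsingleton.elim (α := Fin 0 → D) _ _)
    (LinearMap.ext fun _ => Subsingleton.elim (α := Fin 0 → D) _ _)
    ((systemEquiv_blockSum t (ofSquare K) _).trans (SystemEquiv.trans h
      (systemEquiv_blockSum t (ofSquare K') _).symm))
  exact similarMatrices_of_linearEquiv e he

end RegularPart

/-! ### Numerical invariants -/

section Invariants

variable {D : Type*} [DivisionRing D]
variable {W : Type*} [AddCommGroup W] [Module D W] {Z : Type*} [AddCommGroup Z] [Module D Z]
variable {W' : Type*} [AddCommGroup W'] [Module D W'] {Z' : Type*} [AddCommGroup Z'] [Module D Z']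

/-- Two chains of subspaces of `W`, which an equivalence of systems preserves: for `intoRight`, the
preimages under `a^i` of `0` and of `ker a ∩ ker b`, and for `intoLeft`, the chains that start
with `0` and `W` and continue by `S ↦ a⁻¹ S ∩ ker b`. -/
def chainSpace (a : W →ₗ[D] W) (b : W →ₗ[D] Z) : StripMixing → Bool → ℕ → Submodule D W
  | _, false, 0 => ⊥
  | .intoRight, true, 0 => a.ker ⊓ b.ker
  | .intoLeft, true, 0 => ⊤
  | .intoRight, s, i + 1 => (chainSpace a b .intoRight s i).comap a
  | .intoLeft, s, i + 1 => (chainSpace a b .intoLeft s i).comap a ⊓ b.ker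

theorem SystemEquiv.finrank_chainSpace {t : StripMixing} {a : W →ₗ[D] W} {b : W →ₗ[D] Z}
    {a' : W' →ₗ[D] W'} {b' : W' →ₗ[D] Z'} (h : SystemEquiv t a b a' b') (s : Bool) (i : ℕ) :
    Module.finrank D (chainSpace a b t s i) = Module.finrank D (chainSpace a' b' t s i) := by
  obtain ⟨P, hP⟩ : ∃ P : W ≃ₗ[D] W',
      chainSpace a b t s i = (chainSpace a' b' t s i).comap P.toLinearMap := by
    cases t
    · obtain ⟨P, Q, Y, ha, hb⟩ := h
      refine ⟨P, ?_⟩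
      induction i with
      | zero =>
        cases s
        · ext w; simp [chainSpace]
        · ext w
          simp only [chainSpace, Submodule.mem_inf, LinearMap.mem_ker, Submodule.mem_comap,
            LinearEquiv.coe_coe, ha, hb]
          constructor
          · rintro ⟨h1, h2⟩; simp [h1, h2]
          · rintro ⟨h1, h2⟩
            have h1 : a w = 0 := by simpa using h1
            refine ⟨h1, by simpa [h1] using h2⟩
      | succ i ih =>
        simp only [chainSpace]
        rw [ih]
        ext w
        simp [ha]
    · obtain ⟨P, Q, X, ha, hb⟩ := h
      refine ⟨P, ?_⟩
      induction i with
      | zero => cases s <;> ext w <;> simp [chainSpace]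
      | succ i ih =>
        simp only [chainSpace]
        rw [ih]
        ext w
        simp only [Submodule.mem_inf, LinearMap.mem_ker, Submodule.mem_comap, LinearEquiv.coe_coe,
          ha, hb]
        refine ⟨fun ⟨h1, h2⟩ => ?_, fun ⟨h1, h2⟩ => ?_⟩
        · simp [h2, h1]
        · have h2 : b w = 0 := by simpa using h2
          refine ⟨by simpa [h2] using h1, h2⟩
  rw [hP]
  have : (chainSpace a' b' t s i).comap P.toLinearMap =
      (chainSpace a' b' t s i).map P.symm.toLinearMap := by
    ext w
    simp [Submodule.mem_map_equiv]
  rw [this]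
  exact LinearEquiv.finrank_map_eq P.symm _

theorem chainSpace_prodMap (a : W →ₗ[D] W) (b : W →ₗ[D] Z) (a' : W' →ₗ[D] W') (b' : W' →ₗ[D] Z')
    (t : StripMixing) (s : Bool) (i : ℕ) :
    chainSpace (a.prodMap a') (b.prodMap b') t s i =
      (chainSpace a b t s i).prod (chainSpace a' b' t s i) := by
  induction i with
  | zero =>
    cases t <;> cases s <;> ext w <;> simp [chainSpace, Prod.ext_iff]
  | succ i ih =>
    cases t <;> simp only [chainSpace] <;> rw [ih] <;> ext w <;>
      simp [and_and_and_comm]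

theorem finrank_submodule_prod [FiniteDimensional D W] [FiniteDimensional D W']
    (S : Submodule D W) (S' : Submodule D W') :
    Module.finrank D (S.prod S') = Module.finrank D S + Module.finrank D S' := by
  let e : (S.prod S') ≃ₗ[D] S × S' :=
    { toFun := fun w => (⟨w.1.1, w.2.1⟩, ⟨w.1.2, w.2.2⟩)
      invFun := fun w => ⟨(w.1, w.2), w.1.2, w.2.2⟩
      left_inv := fun _ => rfl
      right_inv := fun _ => rfl
      map_add' := fun _ _ => rfl
      map_smul' := fun _ _ => rfl }
  rw [e.finrank_eq, Module.finrank_prod]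

/-- The dimensions of the two chains of subspaces for the system of `M`. -/
noncomputable def chainDim (M : BlockMatrix D) (t : StripMixing) (s : Bool) (i : ℕ) : ℕ :=
  Module.finrank D (chainSpace M.leftMap M.rightMap t s i)

theorem chainDim_blockSum (M N : BlockMatrix D) (t : StripMixing) (s : Bool) (i : ℕ) :
    chainDim (M.blockSum N) t s i = chainDim M t s i + chainDim N t s i := by
  rw [chainDim, ← (systemEquiv_blockSum t M N).finrank_chainSpace, chainSpace_prodMap,
    finrank_submodule_prod]
  rfl

theorem chainDim_listSum (L : List (BlockMatrix D)) (t : StripMixing) (s : Bool) (i : ℕ) :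
    chainDim (listSum L) t s i = (L.map fun M => chainDim M t s i).sum := by
  induction L with
  | nil =>
    have : Subsingleton (Fin (listSum ([] : List (BlockMatrix D))).rows → D) :=
      inferInstanceAs (Subsingleton (Fin 0 → D))
    exact Module.finrank_zero_of_subsingleton
  | cons M L ih =>
    rw [List.map_cons, List.sum_cons, ← ih]
    exact chainDim_blockSum M (listSum L) t s i

theorem cols_listSum (L : List (BlockMatrix D)) :
    (listSum L).cols = (L.map BlockMatrix.cols).sum := by
  induction L with
  | nil => rfl
  | cons M L ih => rw [List.map_cons, List.sum_cons, ← ih]; rfl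

theorem BlockMatrix.Equivalent.cols_eq {t : StripMixing} {M M' : BlockMatrix D}
    (h : Equivalent t M M') : M.cols = M'.cols := by
  cases t
  · obtain ⟨-, Q, -⟩ := h
    simpa using Q.finrank_eq
  · obtain ⟨-, Q, -⟩ := h
    simpa using Q.finrank_eq

/-- The row vectors of length `n` whose entries at the positions in `p` are zero. -/
def vanishing (D : Type*) [DivisionRing D] {n : ℕ} (p : Fin n → Prop) :
    Submodule D (Fin n → D) where
  carrier := {x | ∀ j, p j → x j = 0}
  add_mem' h h' j hj := by simp [h j hj, h' j hj]
  zero_mem' _ _ := rfl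
  smul_mem' c x h j hj := by simp [h j hj]

theorem mem_vanishing {n : ℕ} {p : Fin n → Prop} {x : Fin n → D} :
    x ∈ vanishing D p ↔ ∀ j, p j → x j = 0 := Iff.rfl

theorem finrank_vanishing {n : ℕ} (p : Fin n → Prop) :
    Module.finrank D (vanishing D p) = Nat.card {j // ¬ p j} := by
  classical
  let e : vanishing D p ≃ₗ[D] ({j // ¬ p j} → D) :=
    { toFun := fun x j => x.1 j
      invFun := fun y => ⟨fun j => if h : p j then 0 else y ⟨j, h⟩, fun j hj => by simp [hj]⟩
      left_inv := fun x => by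
        ext j
        by_cases h : p j
        · simp [h, x.2 j h]
        · simp [h]
      right_inv := fun y => by
        ext j
        simp [j.2]
      map_add' := fun _ _ => rfl
      map_smul' := fun _ _ => rfl }
  rw [e.finrank_eq, Module.finrank_fintype_fun_eq_card, Nat.card_eq_fintype_card]

theorem finrank_vanishing_lt (n i : ℕ) :
    Module.finrank D (vanishing D fun j : Fin n => (j : ℕ) + i < n) = min i n := by
  rw [finrank_vanishing]
  have e : {j : Fin n // ¬ (j : ℕ) + i < n} ≃ Fin (min i n) :=
    { toFun := fun j => ⟨n - 1 - j.1, by have := j.2; have := j.1.2; omega⟩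
      invFun := fun k => ⟨⟨n - 1 - k, by have := k.2; omega⟩, by
        have := k.2; simp only; omega⟩
      left_inv := fun j => by
        have := j.1.2
        ext; simp only; omega
      right_inv := fun k => by
        have := k.2
        ext; simp only; omega }
  exact (Nat.card_congr e).trans (Nat.card_fin _)

theorem finrank_vanishing_ge (n i : ℕ) :
    Module.finrank D (vanishing D fun j : Fin n => n ≤ (j : ℕ) + i) = n - i := by
  rw [finrank_vanishing]
  have e : {j : Fin n // ¬ n ≤ (j : ℕ) + i} ≃ Fin (n - i) :=
    { toFun := fun j => ⟨j.1, by have := j.2; omega⟩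
      invFun := fun k => ⟨⟨k, by have := k.2; omega⟩, by have := k.2; simp only; omega⟩
      left_inv := fun _ => rfl
      right_inv := fun _ => rfl }
  exact (Nat.card_congr e).trans (Nat.card_fin _)

theorem comap_vanishing_lt (n i : ℕ) :
    (vanishing D fun j : Fin n => (j : ℕ) + i < n).comap (jordan n (0 : D)).vecMulLinear =
      vanishing D fun j : Fin n => (j : ℕ) + (i + 1) < n := by
  ext x
  simp only [Submodule.mem_comap, mem_vanishing, vecMulLinear_apply, vecMul_jordan_zero]
  constructor
  · intro h j hj
    have := h ⟨j + 1, by omega⟩ (by simp only; omega)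
    simpa using this
  · intro h j hj
    split_ifs with h0
    · exact h _ (by simp only; omega)
    · rfl

theorem comap_vanishing_ge (n i : ℕ) :
    (vanishing D fun j : Fin n => n ≤ (j : ℕ) + i).comap (jordan n (0 : D)).vecMulLinear ⊓
        (lastColumn n).vecMulLinear.ker =
      vanishing D fun j : Fin n => n ≤ (j : ℕ) + (i + 1) := by
  ext x
  simp only [Submodule.mem_inf, LinearMap.mem_ker, Submodule.mem_comap, mem_vanishing,
    vecMulLinear_apply, vecMul_jordan_zero, funext_iff, vecMul_lastColumn, Pi.zero_apply]
  constructor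
  · rintro ⟨h, h'⟩ j hj
    by_cases hjn : (j : ℕ) + 1 < n
    · have := h ⟨j + 1, hjn⟩ (by simp only; omega)
      simpa using this
    · have := h' 0
      rw [dif_pos (by omega)] at this
      rw [← this]
      congr 1
      ext; simp only; omega
  · intro h
    refine ⟨fun j hj => ?_, fun _ => ?_⟩
    · split_ifs with h0
      · exact h _ (by simp only; omega)
      · rfl
    · split_ifs with h0
      · exact h _ (by simp only; omega)
      · rfl

theorem vanishing_lt_zero (n : ℕ) : (vanishing D fun j : Fin n => (j : ℕ) + 0 < n) = ⊥ := by
  ext x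
  simp only [mem_vanishing, add_zero, Submodule.mem_bot, funext_iff, Pi.zero_apply]
  exact ⟨fun h j => h j j.2, fun h j _ => h j⟩

theorem vanishing_ge_zero (n : ℕ) : (vanishing D fun j : Fin n => n ≤ (j : ℕ) + 0) = ⊤ := by
  ext x
  simp only [mem_vanishing, add_zero, Submodule.mem_top, iff_true]
  exact fun j hj => absurd j.2 (by omega)

theorem ker_jordan (n : ℕ) : (jordan n (0 : D)).vecMulLinear.ker =
    vanishing D fun j : Fin n => (j : ℕ) + 1 < n := by
  rw [← comap_vanishing_lt, vanishing_lt_zero, Submodule.comap_bot]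

theorem ker_jordan_inf_ker_lastColumn (n : ℕ) :
    (jordan n (0 : D)).vecMulLinear.ker ⊓ (lastColumn n).vecMulLinear.ker = ⊥ := by
  rw [eq_bot_iff]
  intro x hx
  rw [ker_jordan] at hx
  obtain ⟨h, h'⟩ := Submodule.mem_inf.1 hx
  rw [LinearMap.mem_ker, vecMulLinear_apply] at h'
  refine (Submodule.mem_bot D).2 (funext fun j => ?_)
  by_cases hjn : (j : ℕ) + 1 < n
  · exact h j hjn
  · have := congrFun h' 0
    rw [vecMul_lastColumn, dif_pos (by omega)] at this
    refine Eq.trans ?_ this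
    congr 1
    ext; simp only; omega

theorem ker_eq_top_of_cols_eq_zero {M : BlockMatrix D} (h : M.cols = 0) : M.rightMap.ker = ⊤ := by
  have : IsEmpty (Fin M.cols) := by rw [h]; infer_instance
  exact LinearMap.ker_eq_top.2 (LinearMap.ext fun _ => Subsingleton.elim _ _)

theorem chainDim_regular {p : ℕ} {K : Matrix (Fin p) (Fin p) D} (hK : IsUnit K) (t : StripMixing)
    (s : Bool) (i : ℕ) : chainDim (ofSquare K) t s i = chainDim (ofSquare K) t s 0 := by
  have hbot : (ofSquare K).leftMap.ker = ⊥ :=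
    LinearMap.ker_eq_bot.2 (vecMul_bijective_of_isUnit hK).1
  have htop := ker_eq_top_of_cols_eq_zero (M := ofSquare K) rfl
  have key : chainSpace (ofSquare K).leftMap (ofSquare K).rightMap t s i =
      chainSpace (ofSquare K).leftMap (ofSquare K).rightMap t s 0 := by
    induction i with
    | zero => rfl
    | succ i ih =>
      cases t <;> cases s <;> simp only [chainSpace] at ih ⊢ <;> rw [ih] <;> simp [hbot, htop]
  rw [chainDim, key]
  rfl

theorem chainDim_regular_intoRight {p : ℕ} {K : Matrix (Fin p) (Fin p) D} (hK : IsUnit K)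
    (s : Bool) (i : ℕ) : chainDim (ofSquare K) .intoRight s i = 0 := by
  have hbot : (ofSquare K).leftMap.ker = ⊥ :=
    LinearMap.ker_eq_bot.2 (vecMul_bijective_of_isUnit hK).1
  rw [chainDim_regular hK, chainDim]
  have key : chainSpace (ofSquare K).leftMap (ofSquare K).rightMap .intoRight s 0 = ⊥ := by
    cases s <;> simp [chainSpace, hbot]
  rw [key]
  exact finrank_bot D _

theorem chainDim_intoRight_false (s : ℕ ⊕ ℕ) (i : ℕ) :
    chainDim (singularSummand D s) .intoRight false i =
      Sum.elim (fun q => min i (q + 1)) (fun q => min i q) s := by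
  have key : chainSpace (singularSummand D s).leftMap (singularSummand D s).rightMap
      .intoRight false i =
      vanishing D fun j => (j : ℕ) + i < (singularSummand D s).rows := by
    induction i with
    | zero => exact (vanishing_lt_zero _).symm
    | succ i ih =>
      simp only [chainSpace]
      rw [ih]
      rcases s with q | q <;> exact comap_vanishing_lt _ i
  rw [chainDim, key, finrank_vanishing_lt]
  rcases s with q | q <;> rfl

theorem chainDim_intoRight_true (s : ℕ ⊕ ℕ) (i : ℕ) :
    chainDim (singularSummand D s) .intoRight true i =
      Sum.elim (fun q => min (i + 1) (q + 1)) (fun q => min i q) s := by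
  rcases s with q | q
  · have key : chainSpace (singularSummand D (.inl q)).leftMap (singularSummand D (.inl q)).rightMap
        .intoRight true i = vanishing D fun j : Fin (q + 1) => (j : ℕ) + (i + 1) < q + 1 := by
      induction i with
      | zero =>
        simp only [chainSpace]
        rw [ker_eq_top_of_cols_eq_zero rfl, inf_top_eq]
        exact ker_jordan (q + 1)
      | succ i ih =>
        simp only [chainSpace]
        rw [ih]
        exact comap_vanishing_lt _ (i + 1)
    rw [chainDim, key]
    exact finrank_vanishing_lt _ _
  · have key : chainSpace (singularSummand D (.inr q)).leftMap (singularSummand D (.inr q)).rightMap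
        .intoRight true i = vanishing D fun j : Fin q => (j : ℕ) + i < q := by
      induction i with
      | zero =>
        simp only [chainSpace]
        exact (ker_jordan_inf_ker_lastColumn q).trans (vanishing_lt_zero q).symm
      | succ i ih =>
        simp only [chainSpace]
        rw [ih]
        exact comap_vanishing_lt _ i
    rw [chainDim, key]
    exact finrank_vanishing_lt _ _

theorem chainDim_intoLeft_false (s : ℕ ⊕ ℕ) (i : ℕ) :
    chainDim (singularSummand D s) .intoLeft false i =
      Sum.elim (fun q => min i (q + 1)) (fun _ => 0) s := by
  rcases s with q | q
  · have key : chainSpace (singularSummand D (.inl q)).leftMap (singularSummand D (.inl q)).rightMap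
        .intoLeft false i = vanishing D fun j : Fin (q + 1) => (j : ℕ) + i < q + 1 := by
      induction i with
      | zero => exact (vanishing_lt_zero _).symm
      | succ i ih =>
        simp only [chainSpace]
        rw [ih, ker_eq_top_of_cols_eq_zero rfl, inf_top_eq]
        exact comap_vanishing_lt _ i
    rw [chainDim, key]
    exact finrank_vanishing_lt _ _
  · have key : chainSpace (singularSummand D (.inr q)).leftMap (singularSummand D (.inr q)).rightMap
        .intoLeft false i = ⊥ := by
      induction i with
      | zero => rfl
      | succ i ih =>
        simp only [chainSpace]
        rw [ih, Submodule.comap_bot]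
        exact ker_jordan_inf_ker_lastColumn q
    rw [chainDim, key]
    exact finrank_bot D _

theorem chainDim_intoLeft_true (s : ℕ ⊕ ℕ) (i : ℕ) :
    chainDim (singularSummand D s) .intoLeft true i =
      Sum.elim (fun q => q + 1) (fun q => q - i) s := by
  rcases s with q | q
  · have key : chainSpace (singularSummand D (.inl q)).leftMap (singularSummand D (.inl q)).rightMap
        .intoLeft true i = ⊤ := by
      induction i with
      | zero => rfl
      | succ i ih =>
        simp only [chainSpace]
        rw [ih, ker_eq_top_of_cols_eq_zero rfl]
        simp
    rw [chainDim, key, finrank_top]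
    exact Module.finrank_fin_fun D
  · have key : chainSpace (singularSummand D (.inr q)).leftMap (singularSummand D (.inr q)).rightMap
        .intoLeft true i = vanishing D fun j : Fin q => q ≤ (j : ℕ) + i := by
      induction i with
      | zero => exact (vanishing_ge_zero q).symm
      | succ i ih =>
        simp only [chainSpace]
        rw [ih]
        exact comap_vanishing_ge q i
    rw [chainDim, key]
    exact finrank_vanishing_ge _ _

end Invariants

/-! ### Uniqueness of the singular summands -/

section Counting

/-- A list is determined up to permutation by the numbers of its terms of each kind that are at
least as long as given. -/
theorem perm_of_sum_map_eq {c c' : List (ℕ ⊕ ℕ)}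
    (h : ∀ i, (c.map (Sum.elim (fun q => if i ≤ q then 1 else 0) fun _ => 0)).sum =
      (c'.map (Sum.elim (fun q => if i ≤ q then 1 else 0) fun _ => 0)).sum)
    (h' : ∀ i, (c.map (Sum.elim (fun _ => 0) fun q => if i ≤ q then 1 else 0)).sum =
      (c'.map (Sum.elim (fun _ => 0) fun q => if i ≤ q then 1 else 0)).sum) : c.Perm c' := by
  let : BEq (ℕ ⊕ ℕ) := instBEqOfDecidableEq
  rw [List.perm_iff_count]
  rintro (i | i)
  · have key : ∀ c : List (ℕ ⊕ ℕ),
        (c.map (Sum.elim (fun q => if i ≤ q then 1 else 0) fun _ => 0)).sum =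
          c.count (.inl i) +
            (c.map (Sum.elim (fun q => if i + 1 ≤ q then 1 else 0) fun _ => 0)).sum := by
      intro c
      induction c with
      | nil => rfl
      | cons s c ih =>
        simp only [List.map_cons, List.sum_cons, ih, List.count_cons]
        rcases s with q | q
        · simp only [Sum.elim_inl, beq_iff_eq, Sum.inl.injEq]
          split_ifs <;> omega
        · simp
    have h1 := h i
    rw [key c, key c', h (i + 1)] at h1
    exact Nat.add_right_cancel h1
  · have key : ∀ c : List (ℕ ⊕ ℕ),
        (c.map (Sum.elim (fun _ => 0) fun q => if i ≤ q then 1 else 0)).sum =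
          c.count (.inr i) +
            (c.map (Sum.elim (fun _ => 0) fun q => if i + 1 ≤ q then 1 else 0)).sum := by
      intro c
      induction c with
      | nil => rfl
      | cons s c ih =>
        simp only [List.map_cons, List.sum_cons, ih, List.count_cons]
        rcases s with q | q
        · simp
        · simp only [Sum.elim_inr, beq_iff_eq, Sum.inr.injEq]
          split_ifs <;> omega
    have h1 := h' i
    rw [key c, key c', h' (i + 1)] at h1
    exact Nat.add_right_cancel h1

theorem sum_map_eq_add {α : Type*} {f g h : α → ℕ} (hfg : ∀ s, f s = g s + h s) (c : List α) :
    (c.map f).sum = (c.map g).sum + (c.map h).sum := by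
  rw [← List.sum_map_add]
  exact congrArg _ (List.map_congr_left fun s _ => hfg s)

variable {D : Type*} [DivisionRing D]

/-- The singular summands are unique up to permutation: differences of the dimensions of the chains
of subspaces count the summands that are at least as long as given. -/
theorem perm_of_equivalent {t : StripMixing} {p p' : ℕ} {K : Matrix (Fin p) (Fin p) D}
    {K' : Matrix (Fin p') (Fin p') D} {c c' : List (ℕ ⊕ ℕ)} (hK : IsUnit K) (hK' : IsUnit K')
    (h : Equivalent t (listSum (ofSquare K :: c.map (singularSummand D)))
      (listSum (ofSquare K' :: c'.map (singularSummand D)))) : c.Perm c' := by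
  have hcols := h.cols_eq
  have hp : p = p' := (similarMatrices_of_equivalent hK hK' h).1
  subst hp
  have hdim : ∀ s i, (c.map fun x => chainDim (singularSummand D x) t s i).sum =
      (c'.map fun x => chainDim (singularSummand D x) t s i).sum := by
    intro s i
    have h1 : chainDim _ t s i = chainDim _ t s i := SystemEquiv.finrank_chainSpace h s i
    rw [chainDim_listSum, chainDim_listSum, List.map_cons, List.map_cons, List.sum_cons,
      List.sum_cons, List.map_map, List.map_map] at h1
    have h2 : chainDim (ofSquare K) t s i = chainDim (ofSquare K') t s i := by
      rw [chainDim_regular hK, chainDim_regular hK']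
      cases t
      · rw [chainDim_regular_intoRight hK, chainDim_regular_intoRight hK']
      · cases s <;> rfl
    rw [h2] at h1
    exact Nat.add_left_cancel h1
  have hzero : (c.map (Sum.elim (fun _ => 0) fun q => if 0 ≤ q then 1 else 0)).sum =
      (c'.map (Sum.elim (fun _ => 0) fun q => if 0 ≤ q then 1 else 0)).sum := by
    rw [cols_listSum, cols_listSum, List.map_cons, List.map_cons, List.sum_cons,
      List.sum_cons, List.map_map, List.map_map] at hcols
    have hf : (BlockMatrix.cols ∘ singularSummand D) =
        Sum.elim (fun _ => 0) fun q => if 0 ≤ q then 1 else 0 := by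
      funext s
      rcases s with q | q <;> rfl
    rw [hf] at hcols
    exact Nat.add_left_cancel hcols
  cases t
  · have hl : ∀ i, (c.map (Sum.elim (fun q => if i ≤ q then 1 else 0) fun _ => 0)).sum =
        (c'.map (Sum.elim (fun q => if i ≤ q then 1 else 0) fun _ => 0)).sum := by
      intro i
      have key := sum_map_eq_add (f := fun x => chainDim (singularSummand D x) .intoRight true i)
        (g := fun x => chainDim (singularSummand D x) .intoRight false i)
        (h := Sum.elim (fun q => if i ≤ q then 1 else 0) fun _ => 0) fun s => by
          simp only [chainDim_intoRight_true, chainDim_intoRight_false]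
          rcases s with q | q
          · simp only [Sum.elim_inl]; split_ifs <;> omega
          · simp
      have h1 := hdim true i
      rw [key c, key c', hdim false i] at h1
      exact Nat.add_left_cancel h1
    refine perm_of_sum_map_eq hl fun i => ?_
    cases i with
    | zero => exact hzero
    | succ i =>
      have key := sum_map_eq_add
        (f := fun x => chainDim (singularSummand D x) .intoRight false (i + 1))
        (g := fun x => chainDim (singularSummand D x) .intoRight true i)
        (h := Sum.elim (fun _ => 0) fun q => if i + 1 ≤ q then 1 else 0) fun s => by
          simp only [chainDim_intoRight_true, chainDim_intoRight_false]
          rcases s with q | q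
          · simp
          · simp only [Sum.elim_inr]; split_ifs <;> omega
      have h1 := hdim false (i + 1)
      rw [key c, key c', hdim true i] at h1
      exact Nat.add_left_cancel h1
  · refine perm_of_sum_map_eq (fun i => ?_) fun i => ?_
    · have key := sum_map_eq_add
        (f := fun x => chainDim (singularSummand D x) .intoLeft false (i + 1))
        (g := fun x => chainDim (singularSummand D x) .intoLeft false i)
        (h := Sum.elim (fun q => if i ≤ q then 1 else 0) fun _ => 0) fun s => by
          simp only [chainDim_intoLeft_false]
          rcases s with q | q
          · simp only [Sum.elim_inl]; split_ifs <;> omega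
          · simp
      have h1 := hdim false (i + 1)
      rw [key c, key c', hdim false i] at h1
      exact Nat.add_left_cancel h1
    · cases i with
      | zero => exact hzero
      | succ i =>
        have key := sum_map_eq_add
          (f := fun x => chainDim (singularSummand D x) .intoLeft true i)
          (g := fun x => chainDim (singularSummand D x) .intoLeft true (i + 1))
          (h := Sum.elim (fun _ => 0) fun q => if i + 1 ≤ q then 1 else 0) fun s => by
            simp only [chainDim_intoLeft_true]
            rcases s with q | q
            · simp
            · simp only [Sum.elim_inr]; split_ifs <;> omega
        have h1 := hdim true i
        rw [key c, key c', hdim true (i + 1)] at h1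
        exact Nat.add_left_cancel h1

end Counting

/-! ### Equivalence of block matrices by matrices of transition -/

section Transition

variable {D : Type*} [DivisionRing D] {ι κ ι' κ' : Type*}

/-- A matrix of transition that mixes the strips in the given way is block triangular: its left
lower block is zero for `intoRight`, and its right upper block is zero for `intoLeft`. -/
def IsTransition (t : StripMixing) (S : Matrix (ι ⊕ κ) (ι' ⊕ κ') D) : Prop :=
  match t with
  | .intoRight => S.toBlocks₂₁ = 0
  | .intoLeft => S.toBlocks₁₂ = 0

theorem IsTransition.mul_blocks [DecidableEq ι] [DecidableEq κ] [Fintype ι'] [Fintype κ']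
    {t : StripMixing} {S : Matrix (ι ⊕ κ) (ι' ⊕ κ') D}
    {S' : Matrix (ι' ⊕ κ') (ι ⊕ κ) D} (hS : IsTransition t S) (hS' : IsTransition t S')
    (h : S * S' = 1) :
    S.toBlocks₁₁ * S'.toBlocks₁₁ = 1 ∧ S.toBlocks₂₂ * S'.toBlocks₂₂ = 1 := by
  rw [← fromBlocks_toBlocks S, ← fromBlocks_toBlocks S', fromBlocks_multiply, ← fromBlocks_one,
    fromBlocks_inj] at h
  obtain ⟨h1, -, -, h2⟩ := h
  cases t
  · have hS : S.toBlocks₂₁ = 0 := hS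
    have hS' : S'.toBlocks₂₁ = 0 := hS'
    simp only [hS, hS', Matrix.mul_zero, Matrix.zero_mul, add_zero, zero_add] at h1 h2
    exact ⟨h1, h2⟩
  · have hS : S.toBlocks₁₂ = 0 := hS
    have hS' : S'.toBlocks₁₂ = 0 := hS'
    simp only [hS, hS', Matrix.mul_zero, Matrix.zero_mul, add_zero, zero_add] at h1 h2
    exact ⟨h1, h2⟩

theorem BlockMatrix.equivalent_iff {t : StripMixing} {M N : BlockMatrix D} :
    Equivalent t M N ↔ ∃ (S : Matrix (Fin M.rows ⊕ Fin M.cols) (Fin N.rows ⊕ Fin N.cols) D)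
      (S' : Matrix (Fin N.rows ⊕ Fin N.cols) (Fin M.rows ⊕ Fin M.cols) D),
      S * S' = 1 ∧ S' * S = 1 ∧ IsTransition t S ∧ IsTransition t S' ∧
        S.toBlocks₁₁ * N.toMatrix = M.toMatrix * S := by
  constructor
  · cases t
    · rintro ⟨P, Q, Y, ha, hb⟩
      obtain ⟨P, P', h1, h2, hP⟩ := exists_matrix_of_linearEquiv P
      obtain ⟨Q, Q', h3, h4, hQ⟩ := exists_matrix_of_linearEquiv Q
      obtain ⟨Y, hY⟩ := exists_matrix_of_linearMap Y
      refine ⟨fromBlocks P Y 0 Q, fromBlocks P' (-(P' * Y * Q')) 0 Q', ?_, ?_, rfl, rfl, ?_⟩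
      · rw [fromBlocks_multiply, ← fromBlocks_one]
        simp [h1, h3, ← Matrix.mul_assoc]
      · rw [fromBlocks_multiply, ← fromBlocks_one]
        simp [h2, h4, Matrix.mul_assoc]
      · rw [toBlocks_fromBlocks₁₁, BlockMatrix.toMatrix, BlockMatrix.toMatrix, mul_fromCols,
          fromCols_mul_fromBlocks]
        congr 1
        · refine eq_of_vecMul_eq fun x => ?_
          have := ha x
          simp only [hP, leftMap_apply] at this
          simpa [vecMul_vecMul] using this
        · refine eq_of_vecMul_eq fun x => ?_
          have := hb x
          simp only [hP, hQ, hY, leftMap_apply, rightMap_apply] at this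
          simpa [vecMul_vecMul, vecMul_add, add_comm] using this
    · rintro ⟨P, Q, X, ha, hb⟩
      obtain ⟨P, P', h1, h2, hP⟩ := exists_matrix_of_linearEquiv P
      obtain ⟨Q, Q', h3, h4, hQ⟩ := exists_matrix_of_linearEquiv Q
      obtain ⟨X, hX⟩ := exists_matrix_of_linearMap X
      refine ⟨fromBlocks P 0 X Q, fromBlocks P' 0 (-(Q' * X * P')) Q', ?_, ?_, rfl, rfl, ?_⟩
      · rw [fromBlocks_multiply, ← fromBlocks_one]
        simp [h1, h3, ← Matrix.mul_assoc]
      · rw [fromBlocks_multiply, ← fromBlocks_one]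
        simp [h2, h4, Matrix.mul_assoc]
      · rw [toBlocks_fromBlocks₁₁, BlockMatrix.toMatrix, BlockMatrix.toMatrix, mul_fromCols,
          fromCols_mul_fromBlocks]
        congr 1
        · refine eq_of_vecMul_eq fun x => ?_
          have := ha x
          simp only [hP, hX, leftMap_apply, rightMap_apply] at this
          simpa [vecMul_vecMul, vecMul_add] using this
        · refine eq_of_vecMul_eq fun x => ?_
          have := hb x
          simp only [hP, hQ, rightMap_apply] at this
          simpa [vecMul_vecMul] using this
  · rintro ⟨S, S', h1, h2, hS, hS', h⟩
    obtain ⟨p1, q1⟩ := hS.mul_blocks hS' h1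
    obtain ⟨p2, q2⟩ := hS'.mul_blocks hS h2
    let P := (Matrix.toLinearEquivRight'OfInv p1 p2).symm
    let Q := (Matrix.toLinearEquivRight'OfInv q1 q2).symm
    have hP : ∀ x, P x = x ᵥ* S.toBlocks₁₁ := fun x => rfl
    have hQ : ∀ x, Q x = x ᵥ* S.toBlocks₂₂ := fun x => rfl
    rw [BlockMatrix.toMatrix, BlockMatrix.toMatrix, mul_fromCols] at h
    nth_rewrite 3 [← fromBlocks_toBlocks S] at h
    rw [fromCols_mul_fromBlocks, fromCols_ext_iff] at h
    obtain ⟨h1, h2⟩ := h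
    cases t
    · have hS : S.toBlocks₂₁ = 0 := hS
      rw [hS, Matrix.mul_zero, add_zero] at h1
      refine ⟨P, Q, S.toBlocks₁₂.vecMulLinear, fun w => ?_, fun w => ?_⟩
      · simp only [hP, leftMap_apply, vecMul_vecMul, h1]
      · simp only [hP, hQ, leftMap_apply, rightMap_apply, vecMul_vecMul, h2, vecMul_add,
          vecMulLinear_apply]
        exact add_comm _ _
    · have hS : S.toBlocks₁₂ = 0 := hS
      rw [hS, Matrix.mul_zero, zero_add] at h2
      refine ⟨P, Q, S.toBlocks₂₁.vecMulLinear, fun w => ?_, fun w => ?_⟩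
      · simp only [hP, leftMap_apply, rightMap_apply, vecMul_vecMul, h1, vecMul_add,
          vecMulLinear_apply]
      · simp only [hP, hQ, rightMap_apply, vecMul_vecMul, h2]

/-- The other way of mixing the strips, which results from transposition of the matrix of
transition. -/
def StripMixing.swap : StripMixing → StripMixing
  | .intoRight => .intoLeft
  | .intoLeft => .intoRight

/-- The statement of `equivalent_iff` for block matrices given by their blocks. -/
theorem BlockMatrix.equivalent_mk_iff {t : StripMixing} {m k m' k' : ℕ}
    {A : Matrix (Fin m) (Fin m) D} {B : Matrix (Fin m) (Fin k) D} {A' : Matrix (Fin m') (Fin m') D}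
    {B' : Matrix (Fin m') (Fin k') D} :
    Equivalent t ⟨m, k, A, B⟩ ⟨m', k', A', B'⟩ ↔
      ∃ (S : Matrix (Fin m ⊕ Fin k) (Fin m' ⊕ Fin k') D)
        (S' : Matrix (Fin m' ⊕ Fin k') (Fin m ⊕ Fin k) D),
      S * S' = 1 ∧ S' * S = 1 ∧ IsTransition t S ∧ IsTransition t S' ∧
        S.toBlocks₁₁ * fromCols A' B' = fromCols A B * S :=
  equivalent_iff

end Transition

/-! ### Matrices of linear mappings of right spaces -/

section RightMatrix

variable {F : Type*} [DivisionRing F] {X Y Z : Type*}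
  [AddCommGroup X] [Module Fᵐᵒᵖ X] [AddCommGroup Y] [Module Fᵐᵒᵖ Y] [AddCommGroup Z] [Module Fᵐᵒᵖ Z]
  {ι κ η : Type*}

theorem apply_eq_sum_rightMatrix [Fintype κ] (f : X →ₗ[Fᵐᵒᵖ] Y) (b : Module.Basis ι Fᵐᵒᵖ X)
    (c : Module.Basis κ Fᵐᵒᵖ Y) (j : ι) : f (b j) = ∑ i, op (rightMatrix f b c i j) • c i := by
  simp [rightMatrix, c.sum_repr]

theorem rightMatrix_eq [Fintype κ] {f : X →ₗ[Fᵐᵒᵖ] Y} {b : Module.Basis ι Fᵐᵒᵖ X}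
    {c : Module.Basis κ Fᵐᵒᵖ Y} {S : Matrix κ ι F} (h : ∀ j, f (b j) = ∑ i, op (S i j) • c i) :
    rightMatrix f b c = S := by
  classical
  ext i j
  simp [rightMatrix, h, Finsupp.single_apply]

theorem rightMatrix_comp [Fintype κ] (f : X →ₗ[Fᵐᵒᵖ] Y) (g : Y →ₗ[Fᵐᵒᵖ] Z)
    (b : Module.Basis ι Fᵐᵒᵖ X) (c : Module.Basis κ Fᵐᵒᵖ Y) (d : Module.Basis η Fᵐᵒᵖ Z) :
    rightMatrix (g ∘ₗ f) b d = rightMatrix g c d * rightMatrix f b c := by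
  ext i j
  have : rightMatrix (g ∘ₗ f) b d i j = unop (d.repr (g (f (b j))) i) := rfl
  rw [this, apply_eq_sum_rightMatrix f b c j, map_sum, map_sum, Finsupp.finsetSum_apply,
    Finset.unop_sum, Matrix.mul_apply]
  refine Finset.sum_congr rfl fun k _ => ?_
  rw [map_smul, map_smul]
  rfl

theorem rightMatrix_id [DecidableEq ι] (b : Module.Basis ι Fᵐᵒᵖ X) :
    rightMatrix LinearMap.id b b = 1 := by
  ext i j
  simp [rightMatrix, Finsupp.single_apply, Matrix.one_apply, eq_comm]
  split_ifs <;> rfl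

theorem rightMatrix_injective [Fintype κ] {f g : X →ₗ[Fᵐᵒᵖ] Y} {b : Module.Basis ι Fᵐᵒᵖ X}
    {c : Module.Basis κ Fᵐᵒᵖ Y} (h : rightMatrix f b c = rightMatrix g b c) : f = g :=
  b.ext fun j => by rw [apply_eq_sum_rightMatrix f b c, apply_eq_sum_rightMatrix g b c, h]

theorem exists_linearMap_rightMatrix [Fintype κ] (b : Module.Basis ι Fᵐᵒᵖ X)
    (c : Module.Basis κ Fᵐᵒᵖ Y) (S : Matrix κ ι F) :
    ∃ f : X →ₗ[Fᵐᵒᵖ] Y, rightMatrix f b c = S :=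
  ⟨b.constr ℕ fun j => ∑ i, op (S i j) • c i, rightMatrix_eq fun j => by rw [b.constr_basis]⟩

/-- An invertible matrix is the matrix of transition to some basis. -/
theorem exists_basis_of_mul_eq_one [Fintype ι] [DecidableEq ι] [Fintype κ] [DecidableEq κ]
    (e : Module.Basis ι Fᵐᵒᵖ X) {S : Matrix ι κ F} {S' : Matrix κ ι F} (h : S * S' = 1)
    (h' : S' * S = 1) : ∃ e' : Module.Basis κ Fᵐᵒᵖ X, rightMatrix LinearMap.id e' e = S := by
  obtain ⟨f, hf⟩ := exists_linearMap_rightMatrix (Pi.basisFun Fᵐᵒᵖ κ) e S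
  obtain ⟨g, hg⟩ := exists_linearMap_rightMatrix e (Pi.basisFun Fᵐᵒᵖ κ) S'
  have h1 : f ∘ₗ g = LinearMap.id := rightMatrix_injective (b := e) (c := e) <| by
    rw [rightMatrix_comp _ _ e (Pi.basisFun Fᵐᵒᵖ κ), hf, hg, h, rightMatrix_id]
  have h2 : g ∘ₗ f = LinearMap.id :=
    rightMatrix_injective (b := Pi.basisFun Fᵐᵒᵖ κ) (c := Pi.basisFun Fᵐᵒᵖ κ) <| by
    rw [rightMatrix_comp _ _ _ e, hf, hg, h', rightMatrix_id]
  refine ⟨Module.Basis.ofEquivFun (LinearEquiv.ofLinearMap g f h2 h1), rightMatrix_eq fun j => ?_⟩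
  rw [← hf, ← apply_eq_sum_rightMatrix]
  simp

variable {V : Type*} [AddCommGroup V] [Module Fᵐᵒᵖ V] {U : Submodule Fᵐᵒᵖ V}
  {ι' κ' : Type*}

theorem rightMatrix_mkQ [Fintype ι] [DecidableEq ι] {e : Module.Basis (ι ⊕ κ) Fᵐᵒᵖ V}
    {b : Module.Basis ι Fᵐᵒᵖ (V ⧸ U)} {c : Module.Basis κ Fᵐᵒᵖ U}
    (hc : ∀ i, (c i : V) = e (.inr i)) (h : ∀ i, b i = U.mkQ (e (.inl i))) :
    rightMatrix U.mkQ e b = fromCols 1 0 :=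
  rightMatrix_eq fun j => by
    rcases j with j | j
    · simp [h, Matrix.one_apply, apply_ite op]
    · simp [← hc]

section Subspace

variable [Fintype ι] [DecidableEq ι] [Fintype κ]
  {e : Module.Basis (ι ⊕ κ) Fᵐᵒᵖ V} {b : Module.Basis ι Fᵐᵒᵖ U}

theorem rightMatrix_subtype (h : ∀ i, (b i : V) = e (.inl i)) :
    rightMatrix U.subtype b e = fromRows 1 0 :=
  rightMatrix_eq fun j => by simp [h, Fintype.sum_sum_type, Matrix.one_apply, apply_ite op]

variable [Fintype ι'] [DecidableEq ι'] {e' : Module.Basis (ι' ⊕ κ') Fᵐᵒᵖ V}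

theorem toBlocks_rightMatrix_of_sub [Fintype κ'] {b' : Module.Basis ι' Fᵐᵒᵖ U}
    (h : ∀ i, (b i : V) = e (.inl i)) (h' : ∀ i, (b' i : V) = e' (.inl i)) :
    (rightMatrix LinearMap.id e' e).toBlocks₁₁ = rightMatrix LinearMap.id b' b ∧
      IsTransition .intoRight (rightMatrix LinearMap.id e' e) := by
  have h1 := rightMatrix_comp U.subtype LinearMap.id b' e' e
  have h2 := rightMatrix_comp LinearMap.id U.subtype b' b e
  rw [rightMatrix_subtype h'] at h1
  rw [rightMatrix_subtype h, LinearMap.comp_id, ← LinearMap.id_comp U.subtype, h1,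
    ← fromBlocks_toBlocks (rightMatrix LinearMap.id e' e), fromBlocks_mul_fromRows,
    fromRows_mul, fromRows_ext_iff] at h2
  simpa [IsTransition] using h2

theorem toBlocks_rightMatrix_of_quot {b : Module.Basis ι Fᵐᵒᵖ (V ⧸ U)}
    {b' : Module.Basis ι' Fᵐᵒᵖ (V ⧸ U)} {c : Module.Basis κ Fᵐᵒᵖ U}
    {c' : Module.Basis κ' Fᵐᵒᵖ U} (hc : ∀ i, (c i : V) = e (.inr i))
    (h : ∀ i, b i = U.mkQ (e (.inl i))) (hc' : ∀ i, (c' i : V) = e' (.inr i))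
    (h' : ∀ i, b' i = U.mkQ (e' (.inl i))) :
    (rightMatrix LinearMap.id e' e).toBlocks₁₁ = rightMatrix LinearMap.id b' b ∧
      IsTransition .intoLeft (rightMatrix LinearMap.id e' e) := by
  have h1 := rightMatrix_comp LinearMap.id U.mkQ e' e b
  have h2 := rightMatrix_comp U.mkQ LinearMap.id e' b' b
  rw [rightMatrix_mkQ hc h] at h1
  rw [rightMatrix_mkQ hc' h', LinearMap.id_comp, ← LinearMap.comp_id U.mkQ, h1,
    ← fromBlocks_toBlocks (rightMatrix LinearMap.id e' e), fromCols_mul_fromBlocks,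
    mul_fromCols, fromCols_ext_iff] at h2
  simpa [IsTransition] using h2

variable [Fintype κ'] [DecidableEq κ] [DecidableEq κ']

theorem exists_basis_of_transition_sub (h : ∀ i, (b i : V) = e (.inl i))
    {S : Matrix (ι ⊕ κ) (ι' ⊕ κ') F} {S' : Matrix (ι' ⊕ κ') (ι ⊕ κ) F} (h1 : S * S' = 1)
    (h2 : S' * S = 1) (hS : IsTransition .intoRight S) (hS' : IsTransition .intoRight S') :
    ∃ (e' : Module.Basis (ι' ⊕ κ') Fᵐᵒᵖ V) (b' : Module.Basis ι' Fᵐᵒᵖ U),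
      (∀ i, (b' i : V) = e' (.inl i)) ∧ rightMatrix LinearMap.id e' e = S := by
  obtain ⟨e', he'⟩ := exists_basis_of_mul_eq_one e h1 h2
  obtain ⟨b', hb'⟩ := exists_basis_of_mul_eq_one b (hS.mul_blocks hS' h1).1
    (hS'.mul_blocks hS h2).1
  refine ⟨e', b', fun j => ?_, he'⟩
  have k1 := apply_eq_sum_rightMatrix LinearMap.id e' e (.inl j)
  have k2 := congrArg U.subtype (apply_eq_sum_rightMatrix LinearMap.id b' b j)
  have hS : ∀ i, S (.inr i) (.inl j) = 0 := fun i => congrFun (congrFun hS i) j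
  rw [he'] at k1
  rw [hb'] at k2
  simp only [LinearMap.id_apply, Fintype.sum_sum_type, hS, op_zero, zero_smul,
    Finset.sum_const_zero, add_zero, map_sum, map_smul, Submodule.subtype_apply, h] at k1 k2
  rw [k1, k2]
  rfl

theorem exists_basis_of_transition_quot {b : Module.Basis ι Fᵐᵒᵖ (V ⧸ U)}
    {c : Module.Basis κ Fᵐᵒᵖ U} (hc : ∀ i, (c i : V) = e (.inr i))
    (h : ∀ i, b i = U.mkQ (e (.inl i)))
    {S : Matrix (ι ⊕ κ) (ι' ⊕ κ') F} {S' : Matrix (ι' ⊕ κ') (ι ⊕ κ) F} (h1 : S * S' = 1)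
    (h2 : S' * S = 1) (hS : IsTransition .intoLeft S) (hS' : IsTransition .intoLeft S') :
    ∃ (e' : Module.Basis (ι' ⊕ κ') Fᵐᵒᵖ V) (b' : Module.Basis ι' Fᵐᵒᵖ (V ⧸ U))
      (c' : Module.Basis κ' Fᵐᵒᵖ U), (∀ i, (c' i : V) = e' (.inr i)) ∧
      (∀ i, b' i = U.mkQ (e' (.inl i))) ∧ rightMatrix LinearMap.id e' e = S := by
  obtain ⟨e', he'⟩ := exists_basis_of_mul_eq_one e h1 h2
  obtain ⟨b', hb'⟩ := exists_basis_of_mul_eq_one b (hS.mul_blocks hS' h1).1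
    (hS'.mul_blocks hS h2).1
  obtain ⟨c', hc'⟩ := exists_basis_of_mul_eq_one c (hS.mul_blocks hS' h1).2
    (hS'.mul_blocks hS h2).2
  refine ⟨e', b', c', fun j => ?_, fun j => ?_, he'⟩
  · have k1 := apply_eq_sum_rightMatrix LinearMap.id e' e (.inr j)
    have k2 := congrArg U.subtype (apply_eq_sum_rightMatrix LinearMap.id c' c j)
    have hS : ∀ i, S (.inl i) (.inr j) = 0 := fun i => congrFun (congrFun hS i) j
    rw [he'] at k1
    rw [hc'] at k2
    simp only [LinearMap.id_apply, Fintype.sum_sum_type, hS, op_zero, zero_smul,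
      Finset.sum_const_zero, zero_add, map_sum, map_smul, Submodule.subtype_apply, hc] at k1 k2
    rw [k1, k2]
    rfl
  · have k1 := congrArg U.mkQ (apply_eq_sum_rightMatrix LinearMap.id e' e (.inl j))
    have k2 := apply_eq_sum_rightMatrix LinearMap.id b' b j
    have hz : ∀ i, U.mkQ (e (.inr i)) = 0 := fun i => by simp [← hc]
    rw [he'] at k1
    rw [hb'] at k2
    simp only [LinearMap.id_apply, Fintype.sum_sum_type, hz, smul_zero,
      Finset.sum_const_zero, add_zero, map_add, map_sum, map_smul, h] at k1 k2
    rw [k1, k2]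
    rfl

end Subspace

theorem exists_adapted_sub [FiniteDimensional Fᵐᵒᵖ V] (U : Submodule Fᵐᵒᵖ V) :
    ∃ (m k : ℕ) (e : Module.Basis (Fin m ⊕ Fin k) Fᵐᵒᵖ V) (b : Module.Basis (Fin m) Fᵐᵒᵖ U),
      ∀ i, (b i : V) = e (.inl i) := by
  obtain ⟨C, hC⟩ := U.exists_isCompl
  exact ⟨_, _, ((Module.finBasis Fᵐᵒᵖ U).prod (Module.finBasis Fᵐᵒᵖ C)).map
    (U.prodEquivOfIsCompl C hC), Module.finBasis Fᵐᵒᵖ U, fun i => by simp⟩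

theorem exists_adapted_quot [FiniteDimensional Fᵐᵒᵖ V] (U : Submodule Fᵐᵒᵖ V) :
    ∃ (m k : ℕ) (e : Module.Basis (Fin m ⊕ Fin k) Fᵐᵒᵖ V) (b : Module.Basis (Fin m) Fᵐᵒᵖ (V ⧸ U))
      (c : Module.Basis (Fin k) Fᵐᵒᵖ U), (∀ i, (c i : V) = e (.inr i)) ∧
      ∀ i, b i = U.mkQ (e (.inl i)) := by
  obtain ⟨C, hC⟩ := U.exists_isCompl
  exact ⟨_, _, ((Module.finBasis Fᵐᵒᵖ C).prod (Module.finBasis Fᵐᵒᵖ U)).map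
    (C.prodEquivOfIsCompl U hC.symm), (Module.finBasis Fᵐᵒᵖ C).map
    (U.quotientEquivOfIsCompl C hC).symm, Module.finBasis Fᵐᵒᵖ U, fun i => by simp,
    fun i => by simp⟩

end RightMatrix

/-! ### Passage to the opposite ring -/

section Opposite

variable {F : Type*} {m n l : Type*}

/-- The transposed matrix over the opposite ring. Unlike transposition over the ring itself, it
reverses products. -/
def transposeOp (A : Matrix m n F) : Matrix n m Fᵐᵒᵖ := Aᵀ.map op

theorem transposeOp_injective : Function.Injective (transposeOp : Matrix m n F → _) := by
  intro A B h
  ext i j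
  exact op_injective (congrFun (congrFun h j) i)

theorem exists_transposeOp_eq (A : Matrix n m Fᵐᵒᵖ) : ∃ B : Matrix m n F, transposeOp B = A :=
  ⟨Aᵀ.map unop, rfl⟩

namespace BlockMatrix

/-- The block matrix with the images of the entries under `f`. -/
def map {F' : Type*} (f : F → F') (M : BlockMatrix F) : BlockMatrix F' :=
  ⟨M.rows, M.cols, M.left.map f, M.right.map f⟩

theorem exists_toMatrix_eq {m k : ℕ} (N : Matrix (Fin m) (Fin m ⊕ Fin k) F) :
    ∃ (A : Matrix (Fin m) (Fin m) F) (B : Matrix (Fin m) (Fin k) F),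
      BlockMatrix.toMatrix ⟨m, k, A, B⟩ = N :=
  ⟨N.toCols₁, N.toCols₂, fromCols_toCols N⟩

end BlockMatrix

variable [DivisionRing F]

theorem transposeOp_mul [Fintype n] (A : Matrix m n F) (B : Matrix n l F) :
    transposeOp (A * B) = transposeOp B * transposeOp A := by
  ext i j
  simp [transposeOp, Matrix.mul_apply]

theorem transposeOp_one [DecidableEq m] : transposeOp (1 : Matrix m m F) = 1 := by
  ext i j
  simp [transposeOp, Matrix.one_apply, apply_ite op]

theorem mul_eq_one_of_transposeOp [Fintype m] [DecidableEq n] {A : Matrix n m F} {B : Matrix m n F}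
    (h : transposeOp B * transposeOp A = 1) : A * B = 1 :=
  transposeOp_injective (by rw [transposeOp_mul, h, transposeOp_one])

theorem isUnit_transposeOp_iff [Fintype m] [DecidableEq m] {A : Matrix m m F} :
    IsUnit (transposeOp A) ↔ IsUnit A := by
  constructor
  · rintro ⟨⟨B, C, h, h'⟩, hB⟩
    obtain ⟨C, rfl⟩ := exists_transposeOp_eq C
    simp only at hB
    subst hB
    exact ⟨⟨A, C, mul_eq_one_of_transposeOp h', mul_eq_one_of_transposeOp h⟩, rfl⟩
  · rintro ⟨⟨A, C, h, h'⟩, rfl⟩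
    refine ⟨⟨transposeOp A, transposeOp C, ?_, ?_⟩, rfl⟩
    · rw [← transposeOp_mul, h', transposeOp_one]
    · rw [← transposeOp_mul, h, transposeOp_one]

theorem similarMatrices_of_transposeOp {p p' : ℕ} {K : Matrix (Fin p) (Fin p) F}
    {K' : Matrix (Fin p') (Fin p') F} (h : SimilarMatrices (transposeOp K) (transposeOp K')) :
    SimilarMatrices K K' := by
  obtain ⟨hp, S, T, h1, h2, h3⟩ := h
  obtain ⟨S, rfl⟩ := exists_transposeOp_eq S
  obtain ⟨T, rfl⟩ := exists_transposeOp_eq T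
  refine ⟨hp, T, S, mul_eq_one_of_transposeOp h1, mul_eq_one_of_transposeOp h2,
    transposeOp_injective ?_⟩
  rw [h3, transposeOp_mul, transposeOp_mul, Matrix.mul_assoc]

namespace BlockMatrix

variable {F' : Type*} [DivisionRing F']

theorem map_ofSquare {f : F → F'} {p : ℕ} (K : Matrix (Fin p) (Fin p) F) :
    (ofSquare K).map f = ofSquare (K.map f) := by
  simp only [map, ofSquare]
  congr 1
  ext i j
  exact j.elim0

theorem map_blockSum {f : F → F'} (hf : f 0 = 0) (M N : BlockMatrix F) :
    (M.blockSum N).map f = (M.map f).blockSum (N.map f) := by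
  have key : ∀ {m m' n n' : ℕ} (A : Matrix (Fin m) (Fin m') F) (B : Matrix (Fin n) (Fin n') F),
      (reindex finSumFinEquiv finSumFinEquiv (fromBlocks A 0 0 B)).map f =
        reindex finSumFinEquiv finSumFinEquiv (fromBlocks (A.map f) 0 0 (B.map f)) := by
    intro m m' n n' A B
    rw [reindex_apply, ← submatrix_map, fromBlocks_map, Matrix.map_zero f hf,
      Matrix.map_zero f hf, reindex_apply]
  exact congrArg₂ (BlockMatrix.mk _ _) (key M.left N.left) (key M.right N.right)

theorem map_listSum {f : F → F'} (hf : f 0 = 0) (L : List (BlockMatrix F)) :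
    (listSum L).map f = listSum (L.map (map f)) := by
  induction L with
  | nil =>
    change map f ⟨0, 0, 0, 0⟩ = ⟨0, 0, 0, 0⟩
    simp only [map, Matrix.map_zero f hf]
  | cons M L ih =>
    change map f (M.blockSum (listSum L)) = (M.map f).blockSum (listSum (L.map (map f)))
    rw [map_blockSum hf, ih]

theorem map_jordan {f : F → F'} (hf : f 0 = 0) (hf1 : f 1 = 1) (q : ℕ) (μ : F) :
    (jordan q μ).map f = jordan q (f μ) := by
  ext i j
  simp [jordan, apply_ite f, hf, hf1]

theorem map_singularSummand {f : F → F'} (hf : f 0 = 0) (hf1 : f 1 = 1) (s : ℕ ⊕ ℕ) :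
    (singularSummand F s).map f = singularSummand F' s := by
  rcases s with q | q
  · rw [singularSummand, map_ofSquare, map_jordan hf hf1, hf]
    rfl
  · have : (lastColumn q : Matrix _ _ F).map f = lastColumn q := by
      ext i j
      simp [lastColumn, apply_ite f, hf, hf1]
    simp only [singularSummand, map, this, map_jordan hf hf1, hf]

theorem map_decomposition {f : F → F'} (hf : f 0 = 0) (hf1 : f 1 = 1) {p : ℕ}
    (K : Matrix (Fin p) (Fin p) F) (c : List (ℕ ⊕ ℕ)) :
    (listSum (ofSquare K :: c.map (singularSummand F))).map f =
      listSum (ofSquare (K.map f) :: c.map (singularSummand F')) := by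
  rw [map_listSum hf, List.map_cons, map_ofSquare, List.map_map]
  congr 2
  exact List.map_congr_left fun s _ => map_singularSummand hf hf1 s

theorem Equivalent.map (f : F →+* F') {t : StripMixing} {M N : BlockMatrix F}
    (h : Equivalent t M N) : Equivalent t (M.map f) (N.map f) := by
  obtain ⟨S, S', h1, h2, hS, hS', h3⟩ := equivalent_iff.1 h
  refine equivalent_mk_iff.2 ⟨S.map f, S'.map f, ?_, ?_, ?_, ?_, ?_⟩
  · rw [← Matrix.map_mul, h1, Matrix.map_one f (map_zero f) (map_one f)]
  · rw [← Matrix.map_mul, h2, Matrix.map_one f (map_zero f) (map_one f)]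
  · cases t <;> exact (congrArg (fun A => Matrix.map A f) hS).trans (Matrix.map_zero f (map_zero f))
  · cases t <;>
      exact (congrArg (fun A => Matrix.map A f) hS').trans (Matrix.map_zero f (map_zero f))
  · rw [← fromCols_map, ← fromCols_map]
    exact Matrix.map_mul.symm.trans ((congrArg (fun A => Matrix.map A f) h3).trans Matrix.map_mul)

/-- Equivalence over the opposite ring, in terms of the transposed matrices over the given ring. -/
theorem equivalent_map_op_iff {t : StripMixing} {M N : BlockMatrix F} :
    Equivalent t (M.map op) (N.map op) ↔
      ∃ (S : Matrix (Fin N.rows ⊕ Fin N.cols) (Fin M.rows ⊕ Fin M.cols) F)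
        (S' : Matrix (Fin M.rows ⊕ Fin M.cols) (Fin N.rows ⊕ Fin N.cols) F),
        S * S' = 1 ∧ S' * S = 1 ∧ IsTransition t.swap S ∧ IsTransition t.swap S' ∧
          S * M.toMatrix.transpose = N.toMatrix.transpose * S.toBlocks₁₁ := by
  have hmap : ∀ R : BlockMatrix F, fromCols (R.left.map op) (R.right.map op) =
      transposeOp R.toMatrix.transpose := fun R => (fromCols_map _ _ op).symm
  have hswap : ∀ {ι κ ι' κ' : Type} (S : Matrix (ι ⊕ κ) (ι' ⊕ κ') F),
      IsTransition t (transposeOp S) ↔ IsTransition t.swap S := by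
    intro ι κ ι' κ' S
    cases t <;> exact ⟨fun h => transposeOp_injective h, fun h => congrArg transposeOp h⟩
  refine equivalent_mk_iff.trans ?_
  rw [hmap, hmap]
  constructor
  · rintro ⟨S, S', h1, h2, hS, hS', h⟩
    obtain ⟨S, rfl⟩ := exists_transposeOp_eq S
    obtain ⟨S', rfl⟩ := exists_transposeOp_eq S'
    refine ⟨S, S', mul_eq_one_of_transposeOp h2, mul_eq_one_of_transposeOp h1, (hswap S).1 hS,
      (hswap S').1 hS', transposeOp_injective ?_⟩
    rw [transposeOp_mul, transposeOp_mul]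
    exact h.symm
  · rintro ⟨S, S', h1, h2, hS, hS', h⟩
    refine ⟨transposeOp S, transposeOp S', ?_, ?_, (hswap S).2 hS, (hswap S').2 hS', ?_⟩
    · rw [← transposeOp_mul, h2, transposeOp_one]
    · rw [← transposeOp_mul, h1, transposeOp_one]
    · rw [← transposeOp_mul, h, transposeOp_mul]
      rfl

end BlockMatrix

end Opposite

/-! ### Forms of a mapping and equivalence of block matrices -/

section Forms

variable {F : Type*} [DivisionRing F] {V : Type*} [AddCommGroup V] [Module Fᵐᵒᵖ V]
  {U : Submodule Fᵐᵒᵖ V}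

theorem rightMatrix_id_mul {ι κ : Type*} [Fintype ι] [Fintype κ] [DecidableEq κ]
    {X : Type*} [AddCommGroup X] [Module Fᵐᵒᵖ X]
    (e : Module.Basis ι Fᵐᵒᵖ X) (e' : Module.Basis κ Fᵐᵒᵖ X) :
    rightMatrix LinearMap.id e e' * rightMatrix LinearMap.id e' e = 1 := by
  rw [← rightMatrix_comp, LinearMap.comp_id, rightMatrix_id]

theorem rightMatrix_change {ι κ ι' κ' : Type*} [Fintype ι] [Fintype κ] [Fintype ι'] [Fintype κ']
    {X Y : Type*} [AddCommGroup X] [Module Fᵐᵒᵖ X] [AddCommGroup Y] [Module Fᵐᵒᵖ Y]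
    (A : X →ₗ[Fᵐᵒᵖ] Y) (b : Module.Basis ι Fᵐᵒᵖ X) (b' : Module.Basis ι' Fᵐᵒᵖ X)
    (c : Module.Basis κ Fᵐᵒᵖ Y) (c' : Module.Basis κ' Fᵐᵒᵖ Y) :
    rightMatrix LinearMap.id c' c * rightMatrix A b' c' =
      rightMatrix A b c * rightMatrix LinearMap.id b' b := by
  rw [← rightMatrix_comp, ← rightMatrix_comp, LinearMap.comp_id, LinearMap.id_comp]

open SubspaceMapping

/-- The way in which a change of an adapted basis mixes the strips. -/
def SubspaceMapping.mixing : SubspaceMapping U → StripMixing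
  | subToSpace _ => .intoLeft
  | spaceToSub _ => .intoRight
  | quotToSpace _ => .intoRight
  | spaceToQuot _ => .intoLeft

theorem hasForm_spaceToSub_iff (A : V →ₗ[Fᵐᵒᵖ] U) {M₀ : BlockMatrix F}
    {e : Module.Basis (Fin M₀.rows ⊕ Fin M₀.cols) Fᵐᵒᵖ V} {b : Module.Basis (Fin M₀.rows) Fᵐᵒᵖ U}
    (hb : ∀ i, (b i : V) = e (.inl i)) (h₀ : rightMatrix A e b = M₀.toMatrix) (M : BlockMatrix F) :
    (spaceToSub A).HasForm M ↔ Equivalent .intoRight M₀ M := by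
  rw [equivalent_iff]
  constructor
  · rintro ⟨e', b', hb', h⟩
    obtain ⟨h1, h2⟩ := toBlocks_rightMatrix_of_sub hb hb'
    refine ⟨_, _, rightMatrix_id_mul e' e, rightMatrix_id_mul e e', h2,
      (toBlocks_rightMatrix_of_sub hb' hb).2, ?_⟩
    rw [h1, ← h, ← h₀, rightMatrix_change A e e' b b']
  · rintro ⟨S, S', h1, h2, hS, hS', h⟩
    obtain ⟨e', b', hb', rfl⟩ := exists_basis_of_transition_sub hb h1 h2 hS hS'
    rw [(toBlocks_rightMatrix_of_sub hb hb').1, ← h₀, ← rightMatrix_change A e e' b b'] at h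
    refine ⟨e', b', hb', ?_⟩
    have := congrArg (fun X => rightMatrix LinearMap.id b b' * X) h
    simp only [← Matrix.mul_assoc, rightMatrix_id_mul, Matrix.one_mul] at this
    exact this.symm

theorem hasForm_spaceToQuot_iff (A : V →ₗ[Fᵐᵒᵖ] V ⧸ U) {M₀ : BlockMatrix F}
    {e : Module.Basis (Fin M₀.rows ⊕ Fin M₀.cols) Fᵐᵒᵖ V}
    {b : Module.Basis (Fin M₀.rows) Fᵐᵒᵖ (V ⧸ U)} {c : Module.Basis (Fin M₀.cols) Fᵐᵒᵖ U}
    (hc : ∀ i, (c i : V) = e (.inr i)) (hb : ∀ i, b i = U.mkQ (e (.inl i)))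
    (h₀ : rightMatrix A e b = M₀.toMatrix) (M : BlockMatrix F) :
    (spaceToQuot A).HasForm M ↔ Equivalent .intoLeft M₀ M := by
  rw [equivalent_iff]
  constructor
  · rintro ⟨e', ⟨c', hc'⟩, b', hb', h⟩
    obtain ⟨h1, h2⟩ := toBlocks_rightMatrix_of_quot hc hb hc' hb'
    refine ⟨_, _, rightMatrix_id_mul e' e, rightMatrix_id_mul e e', h2,
      (toBlocks_rightMatrix_of_quot hc' hb' hc hb).2, ?_⟩
    rw [h1, ← h, ← h₀, rightMatrix_change A e e' b b']
  · rintro ⟨S, S', h1, h2, hS, hS', h⟩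
    obtain ⟨e', b', c', hc', hb', rfl⟩ := exists_basis_of_transition_quot hc hb h1 h2 hS hS'
    rw [(toBlocks_rightMatrix_of_quot hc hb hc' hb').1, ← h₀,
      ← rightMatrix_change A e e' b b'] at h
    refine ⟨e', ⟨c', hc'⟩, b', hb', ?_⟩
    have := congrArg (fun X => rightMatrix LinearMap.id b b' * X) h
    simp only [← Matrix.mul_assoc, rightMatrix_id_mul, Matrix.one_mul] at this
    exact this.symm

theorem hasForm_subToSpace_iff (A : U →ₗ[Fᵐᵒᵖ] V) {M₀ : BlockMatrix F}
    {e : Module.Basis (Fin M₀.rows ⊕ Fin M₀.cols) Fᵐᵒᵖ V} {b : Module.Basis (Fin M₀.rows) Fᵐᵒᵖ U}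
    (hb : ∀ i, (b i : V) = e (.inl i)) (h₀ : (rightMatrix A b e).transpose = M₀.toMatrix)
    (M : BlockMatrix F) :
    (subToSpace A).HasForm M ↔ Equivalent .intoLeft (M.map op) (M₀.map op) := by
  rw [equivalent_map_op_iff, ← h₀, Matrix.transpose_transpose]
  constructor
  · rintro ⟨e', b', hb', h⟩
    obtain ⟨h1, h2⟩ := toBlocks_rightMatrix_of_sub hb hb'
    refine ⟨_, _, rightMatrix_id_mul e' e, rightMatrix_id_mul e e', h2,
      (toBlocks_rightMatrix_of_sub hb' hb).2, ?_⟩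
    rw [h1, ← h, Matrix.transpose_transpose, rightMatrix_change A b b' e e']
  · rintro ⟨S, S', h1, h2, hS, hS', h⟩
    obtain ⟨e', b', hb', rfl⟩ := exists_basis_of_transition_sub hb h1 h2 hS hS'
    rw [(toBlocks_rightMatrix_of_sub hb hb').1, ← rightMatrix_change A b b' e e'] at h
    refine ⟨e', b', hb', ?_⟩
    have := congrArg (fun X => rightMatrix LinearMap.id e e' * X) h
    simp only [← Matrix.mul_assoc, rightMatrix_id_mul, Matrix.one_mul] at this
    rw [← this, Matrix.transpose_transpose]

theorem hasForm_quotToSpace_iff (A : (V ⧸ U) →ₗ[Fᵐᵒᵖ] V) {M₀ : BlockMatrix F}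
    {e : Module.Basis (Fin M₀.rows ⊕ Fin M₀.cols) Fᵐᵒᵖ V}
    {b : Module.Basis (Fin M₀.rows) Fᵐᵒᵖ (V ⧸ U)} {c : Module.Basis (Fin M₀.cols) Fᵐᵒᵖ U}
    (hc : ∀ i, (c i : V) = e (.inr i)) (hb : ∀ i, b i = U.mkQ (e (.inl i)))
    (h₀ : (rightMatrix A b e).transpose = M₀.toMatrix) (M : BlockMatrix F) :
    (quotToSpace A).HasForm M ↔ Equivalent .intoRight (M.map op) (M₀.map op) := by
  rw [equivalent_map_op_iff, ← h₀, Matrix.transpose_transpose]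
  constructor
  · rintro ⟨e', ⟨c', hc'⟩, b', hb', h⟩
    obtain ⟨h1, h2⟩ := toBlocks_rightMatrix_of_quot hc hb hc' hb'
    refine ⟨_, _, rightMatrix_id_mul e' e, rightMatrix_id_mul e e', h2,
      (toBlocks_rightMatrix_of_quot hc' hb' hc hb).2, ?_⟩
    rw [h1, ← h, Matrix.transpose_transpose, rightMatrix_change A b b' e e']
  · rintro ⟨S, S', h1, h2, hS, hS', h⟩
    obtain ⟨e', b', c', hc', hb', rfl⟩ := exists_basis_of_transition_quot hc hb h1 h2 hS hS'
    rw [(toBlocks_rightMatrix_of_quot hc hb hc' hb').1, ← rightMatrix_change A b b' e e'] at h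
    refine ⟨e', ⟨c', hc'⟩, b', hb', ?_⟩
    have := congrArg (fun X => rightMatrix LinearMap.id e e' * X) h
    simp only [← Matrix.mul_assoc, rightMatrix_id_mul, Matrix.one_mul] at this
    rw [← this, Matrix.transpose_transpose]

/-- The forms of a mapping are the members of an equivalence class of block matrices, over the
given ring for `V → U` and `V → V/U` and over the opposite ring for `U → V` and `V/U → V`.
In the first case the block of `A_e` itself is `K`; in the second case it is `Kᵀ`. -/
theorem exists_hasForm_iff [FiniteDimensional Fᵐᵒᵖ V] (𝒜 : SubspaceMapping U) :
    (∃ M₀ : BlockMatrix F, (∀ M, 𝒜.HasForm M ↔ Equivalent 𝒜.mixing M₀ M) ∧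
      ∀ (p : ℕ) (K : Matrix (Fin p) (Fin p) F), 𝒜.untranspose K = K) ∨
    ∃ M₀ : BlockMatrix Fᵐᵒᵖ, (∀ M, 𝒜.HasForm M ↔ Equivalent 𝒜.mixing M₀ (M.map op)) ∧
      ∀ (p : ℕ) (K : Matrix (Fin p) (Fin p) F), 𝒜.untranspose K = K.transpose := by
  cases 𝒜 with
  | subToSpace A =>
    obtain ⟨m, k, e, b, hb⟩ := exists_adapted_sub U
    obtain ⟨A₀, B₀, h₀⟩ := exists_toMatrix_eq (rightMatrix A b e).transpose
    exact .inr ⟨BlockMatrix.map op ⟨m, k, A₀, B₀⟩, fun M =>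
      (hasForm_subToSpace_iff A (M₀ := ⟨m, k, A₀, B₀⟩) hb h₀.symm M).trans
        ⟨SystemEquiv.symm, SystemEquiv.symm⟩, fun _ _ => rfl⟩
  | spaceToSub A =>
    obtain ⟨m, k, e, b, hb⟩ := exists_adapted_sub U
    obtain ⟨A₀, B₀, h₀⟩ := exists_toMatrix_eq (rightMatrix A e b)
    exact .inl ⟨⟨m, k, A₀, B₀⟩, hasForm_spaceToSub_iff A (M₀ := ⟨m, k, A₀, B₀⟩) hb h₀.symm,
      fun _ _ => rfl⟩
  | quotToSpace A =>
    obtain ⟨m, k, e, b, c, hc, hb⟩ := exists_adapted_quot U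
    obtain ⟨A₀, B₀, h₀⟩ := exists_toMatrix_eq (rightMatrix A b e).transpose
    exact .inr ⟨BlockMatrix.map op ⟨m, k, A₀, B₀⟩, fun M =>
      (hasForm_quotToSpace_iff A (M₀ := ⟨m, k, A₀, B₀⟩) hc hb h₀.symm M).trans
        ⟨SystemEquiv.symm, SystemEquiv.symm⟩, fun _ _ => rfl⟩
  | spaceToQuot A =>
    obtain ⟨m, k, e, b, c, hc, hb⟩ := exists_adapted_quot U
    obtain ⟨A₀, B₀, h₀⟩ := exists_toMatrix_eq (rightMatrix A e b)
    exact .inl ⟨⟨m, k, A₀, B₀⟩, hasForm_spaceToQuot_iff A (M₀ := ⟨m, k, A₀, B₀⟩) hc hb h₀.symm,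
      fun _ _ => rfl⟩

theorem exists_isDecomposition [FiniteDimensional Fᵐᵒᵖ V] (𝒜 : SubspaceMapping U) :
    ∃ (p : ℕ) (K : Matrix (Fin p) (Fin p) F) (L : List (BlockMatrix F)),
      𝒜.IsDecomposition K L := by
  rcases exists_hasForm_iff 𝒜 with ⟨M₀, hM₀, hK₀⟩ | ⟨M₀, hM₀, hK₀⟩
  · obtain ⟨p, K, c, hK, h⟩ := exists_decomposition 𝒜.mixing M₀.leftMap M₀.rightMap
    exact ⟨p, K, c.map (singularSummand F), by rwa [hK₀], forall_isSingularSummand_iff.2 ⟨c, rfl⟩,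
      (hM₀ _).2 h.symm⟩
  · obtain ⟨p, K, c, hK, h⟩ := exists_decomposition 𝒜.mixing M₀.leftMap M₀.rightMap
    obtain ⟨K, rfl⟩ := exists_transposeOp_eq K
    refine ⟨p, K.transpose, c.map (singularSummand F), ?_, forall_isSingularSummand_iff.2 ⟨c, rfl⟩,
      (hM₀ _).2 ?_⟩
    · rw [hK₀, Matrix.transpose_transpose]
      exact isUnit_transposeOp_iff.1 hK
    · rw [map_decomposition op_zero op_one]
      exact h.symm

theorem isDecomposition_unique [FiniteDimensional Fᵐᵒᵖ V] (𝒜 : SubspaceMapping U) {p p' : ℕ}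
    {K : Matrix (Fin p) (Fin p) F} {K' : Matrix (Fin p') (Fin p') F} {L L' : List (BlockMatrix F)}
    (h : 𝒜.IsDecomposition K L) (h' : 𝒜.IsDecomposition K' L') :
    SimilarMatrices (𝒜.untranspose K) (𝒜.untranspose K') ∧ L.Perm L' := by
  obtain ⟨hK, hL, h⟩ := h
  obtain ⟨hK', hL', h'⟩ := h'
  obtain ⟨c, rfl⟩ := forall_isSingularSummand_iff.1 hL
  obtain ⟨c', rfl⟩ := forall_isSingularSummand_iff.1 hL'
  rcases exists_hasForm_iff 𝒜 with ⟨M₀, hM₀, hK₀⟩ | ⟨M₀, hM₀, hK₀⟩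
  · rw [hK₀] at hK hK'
    have key := ((hM₀ _).1 h).symm.trans ((hM₀ _).1 h')
    rw [hK₀, hK₀]
    exact ⟨similarMatrices_of_equivalent hK hK' key, (perm_of_equivalent hK hK' key).map _⟩
  · rw [hK₀] at hK hK'
    have key := ((hM₀ _).1 h).symm.trans ((hM₀ _).1 h')
    rw [map_decomposition op_zero op_one, map_decomposition op_zero op_one] at key
    have hU := isUnit_transposeOp_iff.2 hK
    have hU' := isUnit_transposeOp_iff.2 hK'
    rw [hK₀, hK₀]
    exact ⟨similarMatrices_of_transposeOp (similarMatrices_of_equivalent hU hU' key),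
      (perm_of_equivalent hU hU' key).map _⟩

end Forms

/-! ### The Jordan form of the regular summand -/

namespace BlockMatrix

section Field

variable {k : Type*} [Field k]

/-- The block matrix `[A - μ|B]`. -/
def shift (μ : k) (M : BlockMatrix k) : BlockMatrix k :=
  ⟨M.rows, M.cols, M.left - Matrix.scalar (Fin M.rows) μ, M.right⟩

theorem shift_blockSum (μ : k) (M N : BlockMatrix k) :
    (M.blockSum N).shift μ = (M.shift μ).blockSum (N.shift μ) := by
  have key : reindex finSumFinEquiv finSumFinEquiv (fromBlocks M.left 0 0 N.left) -
        Matrix.scalar (Fin (M.rows + N.rows)) μ =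
      reindex finSumFinEquiv finSumFinEquiv (fromBlocks (M.left - Matrix.scalar (Fin M.rows) μ) 0 0
        (N.left - Matrix.scalar (Fin N.rows) μ)) := by
    have h : Matrix.scalar (Fin (M.rows + N.rows)) μ =
        reindex finSumFinEquiv finSumFinEquiv (fromBlocks (Matrix.scalar (Fin M.rows) μ) 0 0
          (Matrix.scalar (Fin N.rows) μ)) := by
      simp only [Matrix.scalar_apply, fromBlocks_diagonal, reindex_apply, submatrix_diagonal_equiv]
      congr 1
      funext i
      simp only [Function.comp_apply]
      rcases finSumFinEquiv.symm i with j | j <;> rfl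
    rw [h]
    ext i j
    simp only [Matrix.sub_apply, reindex_apply, submatrix_apply]
    rcases finSumFinEquiv.symm i with i | i <;> rcases finSumFinEquiv.symm j with j | j <;> simp
  exact congrArg (fun A => (⟨_, _, A, (M.blockSum N).right⟩ : BlockMatrix k)) key

theorem shift_listSum (μ : k) (L : List (BlockMatrix k)) :
    (listSum L).shift μ = listSum (L.map (shift μ)) := by
  induction L with
  | nil =>
    exact congrArg (fun A => (⟨0, 0, A, 0⟩ : BlockMatrix k)) (Subsingleton.elim _ _)
  | cons M L ih =>
    change shift μ (M.blockSum (listSum L)) = (M.shift μ).blockSum (listSum (L.map (shift μ)))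
    rw [shift_blockSum, ih]

theorem shift_ofSquare (μ : k) {p : ℕ} (K : Matrix (Fin p) (Fin p) k) :
    (ofSquare K).shift μ = ofSquare (K - Matrix.scalar (Fin p) μ) := rfl

theorem jordan_sub_scalar (q : ℕ) (μ ν : k) :
    jordan q ν - Matrix.scalar (Fin q) μ = jordan q (ν - μ) := by
  ext i j
  by_cases h : i = j
  · subst h; simp [jordan]
  · simp [jordan, h]

/-- The Jordan summand `[J_{q+1}(μ)|0]` for the pair `(μ, q)`. -/
def jordanSummand (x : k × ℕ) : BlockMatrix k := ofSquare (jordan (x.2 + 1) x.1)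

theorem shift_jordanSummand (μ : k) (x : k × ℕ) :
    (jordanSummand x).shift μ = jordanSummand (x.1 - μ, x.2) := by
  rw [jordanSummand, shift_ofSquare, jordan_sub_scalar]
  rfl

theorem cols_listSum_jordanSummand (c : List (k × ℕ)) :
    (listSum (c.map jordanSummand)).cols = 0 := by
  rw [cols_listSum, List.map_map]
  induction c with
  | nil => rfl
  | cons x c ih => rw [List.map_cons, List.sum_cons, ih]; rfl

theorem eq_ofSquare_of_cols_eq_zero {M : BlockMatrix k} (h : M.cols = 0) :
    M = ofSquare M.left := by
  obtain ⟨m, n, A, B⟩ := M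
  simp only at h
  subst h
  exact congrArg (fun B => (⟨m, 0, A, B⟩ : BlockMatrix k)) (by ext i j; exact j.elim0)

theorem Equivalent.exists_linearEquiv_of_cols_eq_zero {t : StripMixing} {M N : BlockMatrix k}
    (h : Equivalent t M N) (hM : M.cols = 0) :
    ∃ P : (Fin M.rows → k) ≃ₗ[k] (Fin N.rows → k), ∀ x, P x ᵥ* N.left = P (x ᵥ* M.left) := by
  obtain ⟨P, hP, -⟩ := SystemEquiv.exists_linearEquiv h
  have : IsEmpty (Fin M.cols) := by rw [hM]; infer_instance
  exact ⟨P, fun x => hP x (Subsingleton.elim _ _)⟩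

theorem Equivalent.similarMatrices {t : StripMixing} {M N : BlockMatrix k}
    (h : Equivalent t M N) (hM : M.cols = 0) : SimilarMatrices M.left N.left := by
  obtain ⟨P, hP⟩ := h.exists_linearEquiv_of_cols_eq_zero hM
  exact similarMatrices_of_linearEquiv P hP

theorem equivalent_of_linearEquiv {M N : BlockMatrix k} (t : StripMixing) (hM : M.cols = 0)
    (hN : N.cols = 0) (P : (Fin M.rows → k) ≃ₗ[k] (Fin N.rows → k))
    (hP : ∀ x, P x ᵥ* N.left = P (x ᵥ* M.left)) : Equivalent t M N := by
  have : IsEmpty (Fin M.cols) := by rw [hM]; infer_instance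
  have : IsEmpty (Fin N.cols) := by rw [hN]; infer_instance
  exact .of_linearEquiv P (LinearEquiv.ofSubsingleton _ _) hP fun _ => Subsingleton.elim _ _

theorem vecMul_scalar {n : ℕ} (μ : k) (x : Fin n → k) : x ᵥ* Matrix.scalar (Fin n) μ = μ • x := by
  funext j
  simp [vecMul_diagonal, mul_comm]

theorem Equivalent.shift {t : StripMixing} {M N : BlockMatrix k} (h : Equivalent t M N)
    (hM : M.cols = 0) (μ : k) : Equivalent t (M.shift μ) (N.shift μ) := by
  obtain ⟨P, hP⟩ := h.exists_linearEquiv_of_cols_eq_zero hM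
  have key (x : Fin M.rows → k) : P x ᵥ* (N.left - Matrix.scalar (Fin N.rows) μ) =
      P (x ᵥ* (M.left - Matrix.scalar (Fin M.rows) μ)) := by
    rw [vecMul_sub, vecMul_sub, vecMul_scalar, vecMul_scalar, map_sub, map_smul, hP]
  exact equivalent_of_linearEquiv t hM (h.cols_eq.symm.trans hM) P key

theorem equivalent_of_similarMatrices {p p' : ℕ} {K : Matrix (Fin p) (Fin p) k}
    {K' : Matrix (Fin p') (Fin p') k} (t : StripMixing) (h : SimilarMatrices K K') :
    Equivalent t (ofSquare K) (ofSquare K') := by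
  obtain ⟨-, S, T, h1, h2, rfl⟩ := h
  have key (x : Fin p → k) : (x ᵥ* S) ᵥ* (T * K * S) = (x ᵥ* K) ᵥ* S := by
    rw [vecMul_vecMul, vecMul_vecMul, ← Matrix.mul_assoc, ← Matrix.mul_assoc, h1, Matrix.one_mul]
  exact equivalent_of_linearEquiv t rfl rfl (Matrix.toLinearEquivRight'OfInv h1 h2).symm key

theorem isUnit_jordan (q : ℕ) {μ : k} (hμ : μ ≠ 0) : IsUnit (jordan q μ) := by
  have htri : (jordan q μ).BlockTriangular id := fun i j hij => by
    have h : (j : ℕ) < i := hij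
    simp [jordan, show i ≠ j from hij.ne', show (j : ℕ) ≠ i + 1 by omega]
  rw [Matrix.isUnit_iff_isUnit_det, Matrix.det_of_isUpperTriangular htri]
  simp [jordan, hμ]

theorem chainDim_jordanSummand (x : k × ℕ) [Decidable (x.1 = 0)] (i : ℕ) :
    chainDim (jordanSummand x) .intoRight false i = if x.1 = 0 then min i (x.2 + 1) else 0 := by
  obtain ⟨μ, q⟩ := x
  split_ifs with h
  · obtain rfl : μ = 0 := h
    exact chainDim_intoRight_false (.inl q) i
  · have hu : IsUnit (jordan (q + 1) μ) := isUnit_jordan (q + 1) h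
    rw [jordanSummand]
    exact chainDim_regular_intoRight hu false i

open Classical in
/-- The dimensions of the kernels of the powers of `A - μ`. -/
theorem chainDim_shift_listSum (c : List (k × ℕ)) (μ : k) (i : ℕ) :
    chainDim ((listSum (c.map jordanSummand)).shift μ) .intoRight false i =
      (c.map fun x => if x.1 = μ then min i (x.2 + 1) else 0).sum := by
  rw [shift_listSum, chainDim_listSum, List.map_map, List.map_map]
  congr 1
  refine List.map_congr_left fun x _ => ?_
  simp only [Function.comp_apply, shift_jordanSummand, chainDim_jordanSummand, sub_eq_zero]

/-- A list of pairs is determined up to permutation by the dimensions of the kernels. -/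
theorem perm_of_equivalent_jordan {t : StripMixing} {c c' : List (k × ℕ)}
    (h : Equivalent t (listSum (c.map jordanSummand)) (listSum (c'.map jordanSummand))) :
    c.Perm c' := by
  classical
  have hc : Subsingleton (Fin (listSum (c.map (jordanSummand (k := k)))).cols → k) := by
    rw [cols_listSum_jordanSummand]; infer_instance
  have h0 : Equivalent .intoRight (listSum (c.map jordanSummand))
      (listSum (c'.map jordanSummand)) :=
    SystemEquiv.of_subsingleton _ h
  have hdim : ∀ μ i, (c.map fun x => if x.1 = μ then min i (x.2 + 1) else 0).sum =
      (c'.map fun x => if x.1 = μ then min i (x.2 + 1) else 0).sum := by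
    intro μ i
    rw [← chainDim_shift_listSum, ← chainDim_shift_listSum]
    exact SystemEquiv.finrank_chainSpace (h0.shift (cols_listSum_jordanSummand c) μ) false i
  have hlong : ∀ μ i, (c.map fun x => if x.1 = μ ∧ i ≤ x.2 then 1 else 0).sum =
      (c'.map fun x => if x.1 = μ ∧ i ≤ x.2 then 1 else 0).sum := by
    intro μ i
    have key := sum_map_eq_add
      (f := fun x : k × ℕ => if x.1 = μ then min (i + 1) (x.2 + 1) else 0)
      (g := fun x => if x.1 = μ then min i (x.2 + 1) else 0)
      (h := fun x => if x.1 = μ ∧ i ≤ x.2 then 1 else 0) fun x => by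
        by_cases hx : x.1 = μ
        · simp only [hx, if_true, true_and]; split_ifs <;> omega
        · simp [hx]
    have h1 := hdim μ (i + 1)
    rw [key c, key c', hdim μ i] at h1
    exact Nat.add_left_cancel h1
  let : BEq (k × ℕ) := instBEqOfDecidableEq
  rw [List.perm_iff_count]
  rintro ⟨μ, i⟩
  have key := sum_map_eq_add
    (f := fun x : k × ℕ => if x.1 = μ ∧ i ≤ x.2 then 1 else 0)
    (g := fun x => if x.1 = μ ∧ i + 1 ≤ x.2 then 1 else 0)
    (h := fun x => if x = (μ, i) then 1 else 0) fun x => by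
      by_cases hx : x.1 = μ
      · simp only [Prod.ext_iff, hx, true_and]; split_ifs <;> omega
      · simp [Prod.ext_iff, hx]
  have hcount : ∀ c : List (k × ℕ), (c.map fun x => if x = (μ, i) then 1 else 0).sum =
      c.count (μ, i) := by
    intro c
    induction c with
    | nil => rfl
    | cons x c ih => simp [ih, List.count_cons, add_comm]
  have h1 := hlong μ i
  rw [key c, key c', hlong μ (i + 1), hcount, hcount] at h1
  exact Nat.add_left_cancel h1

/-- A direct sum of nonsingular Jordan blocks is nonsingular. -/
theorem isUnit_left_listSum {c : List (k × ℕ)} (hc : ∀ x ∈ c, x.1 ≠ 0) :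
    IsUnit (listSum (c.map jordanSummand)).left := by
  rw [← Matrix.vecMul_injective_iff_isUnit]
  change Function.Injective (listSum (c.map jordanSummand)).leftMap
  rw [← LinearMap.ker_eq_bot]
  classical
  have h : chainDim (listSum (c.map jordanSummand)) .intoRight false 1 = 0 := by
    rw [chainDim_listSum, List.map_map]
    refine List.sum_eq_zero fun n hn => ?_
    obtain ⟨x, hx, rfl⟩ := List.mem_map.1 hn
    rw [Function.comp_apply, chainDim_jordanSummand, if_neg (hc x hx)]
  rw [chainDim, Submodule.finrank_eq_zero] at h
  exact h

theorem ne_zero_of_isUnit_left_listSum {c : List (k × ℕ)}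
    (h : IsUnit (listSum (c.map jordanSummand)).left) : ∀ x ∈ c, x.1 ≠ 0 := by
  classical
  have h1 : chainDim (listSum (c.map jordanSummand)) .intoRight false 1 = 0 := by
    rw [eq_ofSquare_of_cols_eq_zero (cols_listSum_jordanSummand c)]
    exact chainDim_regular_intoRight h false 1
  rw [chainDim_listSum, List.map_map] at h1
  intro x hx h0
  have h2 := List.single_le_sum (fun _ _ => Nat.zero_le _) _ (List.mem_map_of_mem
    (f := (fun M => chainDim M .intoRight false 1) ∘ jordanSummand) hx)
  rw [h1, Function.comp_apply, chainDim_jordanSummand, if_pos h0] at h2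
  omega

/-- Jordan's theorem, by splitting off the nilpotent part of `K - μ` for an eigenvalue `μ`. -/
theorem exists_jordan [IsAlgClosed k] {p : ℕ} (K : Matrix (Fin p) (Fin p) k) :
    ∃ c : List (k × ℕ), Equivalent .intoRight (ofSquare K) (listSum (c.map jordanSummand)) := by
  induction p using Nat.strong_induction_on with
  | _ p ih =>
  rcases Nat.eq_zero_or_pos p with rfl | hp
  · exact ⟨[], equivalent_of_linearEquiv _ rfl rfl 
      (.refl k (Fin 0 → k)) fun x => Subsingleton.elim (α := Fin 0 → k) _ _⟩
  have : NeZero p := ⟨hp.ne'⟩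
  obtain ⟨μ, hμ⟩ := Module.End.exists_eigenvalue K.vecMulLinear
  obtain ⟨x, hx⟩ := hμ.exists_hasEigenvector
  have hx0 : (ofSquare (K - Matrix.scalar (Fin p) μ)).leftMap x = 0 := by
    change x ᵥ* (K - Matrix.scalar (Fin p) μ) = 0
    rw [vecMul_sub, vecMul_scalar, sub_eq_zero]
    exact hx.apply_eq_smul
  obtain ⟨p₁, K₁, d, hK₁, h⟩ := exists_decomposition .intoRight
    (ofSquare (K - Matrix.scalar (Fin p) μ)).leftMap
    (ofSquare (K - Matrix.scalar (Fin p) μ)).rightMap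
  have hcols : (listSum (ofSquare K₁ :: d.map (singularSummand k))).cols = 0 :=
    Equivalent.cols_eq (M' := ofSquare (K - Matrix.scalar (Fin p) μ)) h
  obtain ⟨d, rfl⟩ : ∃ d' : List ℕ, d = d'.map .inl := by
    rw [cols_listSum, List.map_cons, List.sum_cons, List.map_map] at hcols
    have hz := (Nat.add_eq_zero_iff.1 hcols).2
    clear h hcols
    induction d with
    | nil => exact ⟨[], rfl⟩
    | cons s d ihd =>
      rw [List.map_cons, List.sum_cons, Nat.add_eq_zero_iff] at hz
      obtain ⟨d', rfl⟩ := ihd hz.2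
      rcases s with q | q
      · exact ⟨q :: d', rfl⟩
      · exact absurd hz.1 one_ne_zero
  have hlist : (d.map Sum.inl).map (singularSummand k) =
      (d.map fun q => ((0 : k), q)).map jordanSummand := by
    rw [List.map_map, List.map_map]
    rfl
  have hshift := (Equivalent.shift
    (M := listSum (ofSquare K₁ :: (d.map Sum.inl).map (singularSummand k)))
    (N := ofSquare (K - Matrix.scalar (Fin p) μ)) h hcols (-μ)).symm
  have hback : (ofSquare (K - Matrix.scalar (Fin p) μ)).shift (-μ) = ofSquare K := by
    rw [shift_ofSquare, map_neg, sub_neg_eq_add, sub_add_cancel]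
  have hjor : ((d.map fun q => ((0 : k), q)).map jordanSummand).map (BlockMatrix.shift (-μ)) =
      (d.map fun q => (μ, q)).map jordanSummand := by
    simp [List.map_map, Function.comp_def, shift_jordanSummand]
  rw [hback, hlist, shift_listSum, List.map_cons, hjor, shift_ofSquare] at hshift
  -- An eigenvector for `μ` is in the kernel of `K - μ`, so at least one nilpotent block occurs.
  have hrows : p₁ < p := by
    have hlt : p = p₁ + (listSum ((d.map Sum.inl).map (singularSummand k))).rows := by
      obtain ⟨P, -⟩ := SystemEquiv.exists_linearEquiv h
      have h3 := P.finrank_eq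
      rw [Module.finrank_fin_fun, Module.finrank_fin_fun] at h3
      exact h3.symm
    rcases d with - | ⟨q, d⟩
    · exfalso
      obtain ⟨P, hP, -⟩ := SystemEquiv.exists_linearEquiv (SystemEquiv.symm h)
      have h1 := hP x (Subsingleton.elim (α := Fin 0 → k) _ _)
      rw [hx0, map_zero] at h1
      have hdim : chainDim (listSum (ofSquare K₁ :: ([].map Sum.inl).map (singularSummand k)))
          .intoRight false 1 = 0 := by
        rw [chainDim_listSum]
        simp [chainDim_regular_intoRight hK₁]
      rw [chainDim, Submodule.finrank_eq_zero] at hdim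
      have h2 : P x = 0 := LinearMap.ker_eq_bot'.1 hdim _ h1
      exact hx.2 (P.map_eq_zero_iff.1 h2)
    · rw [hlt]
      have : (listSum (((q :: d).map Sum.inl).map (singularSummand k))).rows =
          (q + 1) + (listSum ((d.map Sum.inl).map (singularSummand k))).rows := rfl
      omega
  obtain ⟨c₁, hc₁⟩ := ih p₁ hrows (K₁ - Matrix.scalar (Fin p₁) (-μ))
  refine ⟨c₁ ++ d.map fun q => (μ, q), SystemEquiv.trans hshift ?_⟩
  rw [List.map_append]
  exact (Equivalent.blockSum hc₁ (.refl ..)).trans (Equivalent.listSum_append ..).symm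

end Field

end BlockMatrix

/-! ### Canonical forms -/

section Canonical

variable {k : Type*} [Field k] {V : Type*} [AddCommGroup V] [Module kᵐᵒᵖ V]
  {U : Submodule kᵐᵒᵖ V}

theorem forall_isRegularJordanSummand_iff {L : List (BlockMatrix k)} :
    (∀ M ∈ L, M.IsRegularJordanSummand) ↔
      ∃ c : List (k × ℕ), L = c.map jordanSummand ∧ ∀ x ∈ c, x.1 ≠ 0 := by
  constructor
  · intro h
    induction L with
    | nil => exact ⟨[], rfl, by simp⟩
    | cons M L ih =>
      obtain ⟨c, rfl, hc⟩ := ih fun N hN => h N (by simp [hN])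
      obtain ⟨q, μ, hq, hμ, rfl⟩ := h M (by simp)
      obtain ⟨q, rfl⟩ := Nat.exists_eq_add_of_le' hq
      refine ⟨(μ, q) :: c, rfl, ?_⟩
      intro x hx
      rcases List.mem_cons.1 hx with rfl | hx
      · exact hμ
      · exact hc x hx
  · rintro ⟨c, rfl, hc⟩ M hM
    obtain ⟨x, hx, rfl⟩ := List.mem_map.1 hM
    exact ⟨x.2 + 1, x.1, by omega, hc x hx, rfl⟩

namespace SubspaceMapping

theorem HasForm.congr [FiniteDimensional kᵐᵒᵖ V] {𝒜 : SubspaceMapping U} {M N : BlockMatrix k}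
    (hM : 𝒜.HasForm M) (h : Equivalent 𝒜.mixing M N) : 𝒜.HasForm N := by
  rcases exists_hasForm_iff 𝒜 with ⟨M₀, hM₀, -⟩ | ⟨M₀, hM₀, -⟩
  · exact (hM₀ N).2 (((hM₀ M).1 hM).trans h)
  · exact (hM₀ N).2 (((hM₀ M).1 hM).trans (h.map (RingEquiv.toOpposite k).toRingHom))

theorem isUnit_untranspose_iff (𝒜 : SubspaceMapping U) {p : ℕ} {K : Matrix (Fin p) (Fin p) k} :
    IsUnit (𝒜.untranspose K) ↔ IsUnit K := by
  cases 𝒜 with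
  | subToSpace A => exact Matrix.isUnit_transpose K
  | spaceToSub A => exact Iff.rfl
  | quotToSpace A => exact Matrix.isUnit_transpose K
  | spaceToQuot A => exact Iff.rfl

theorem similarMatrices_transpose {p p' : ℕ} {K : Matrix (Fin p) (Fin p) k}
    {K' : Matrix (Fin p') (Fin p') k} (h : SimilarMatrices K.transpose K'.transpose) :
    SimilarMatrices K K' := by
  obtain ⟨hp, S, T, h1, h2, h3⟩ := h
  refine ⟨hp, T.transpose, S.transpose, ?_, ?_, ?_⟩
  · rw [← Matrix.transpose_mul, h1, Matrix.transpose_one]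
  · rw [← Matrix.transpose_mul, h2, Matrix.transpose_one]
  · apply Matrix.transpose_injective
    rw [h3]
    simp [Matrix.mul_assoc]

theorem similarMatrices_of_untranspose (𝒜 : SubspaceMapping U) {p p' : ℕ}
    {K : Matrix (Fin p) (Fin p) k} {K' : Matrix (Fin p') (Fin p') k}
    (h : SimilarMatrices (𝒜.untranspose K) (𝒜.untranspose K')) : SimilarMatrices K K' := by
  cases 𝒜 with
  | subToSpace A => exact similarMatrices_transpose h
  | spaceToSub A => exact h
  | quotToSpace A => exact similarMatrices_transpose h
  | spaceToQuot A => exact h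

theorem IsDecomposition.exists_jordan [IsAlgClosed k] [FiniteDimensional kᵐᵒᵖ V]
    {𝒜 : SubspaceMapping U} {p : ℕ} {K : Matrix (Fin p) (Fin p) k} {L : List (BlockMatrix k)}
    (h : 𝒜.IsDecomposition K L) :
    ∃ J : List (BlockMatrix k), (∀ M ∈ J, M.IsRegularJordanSummand) ∧
      SimilarMatrices K (listSum J).left ∧ 𝒜.IsCanonicalForm (J ++ L) := by
  obtain ⟨hK, hL, hform⟩ := h
  obtain ⟨c, hc⟩ := BlockMatrix.exists_jordan K
  have hsim : SimilarMatrices K (listSum (c.map jordanSummand)).left := hc.similarMatrices rfl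
  have hunit : IsUnit (listSum (c.map jordanSummand)).left := by
    rw [isUnit_untranspose_iff] at hK
    obtain ⟨-, S, T, h1, h2, h3⟩ := hsim
    obtain ⟨⟨K, K', k1, k2⟩, rfl⟩ := hK
    rw [h3]
    refine ⟨⟨T * K * S, T * K' * S, ?_, ?_⟩, rfl⟩
    · rw [show T * K * S * (T * K' * S) = T * (K * (S * T) * K') * S by
        simp only [Matrix.mul_assoc], h1, Matrix.mul_one, k1, Matrix.mul_one, h2]
    · rw [show T * K' * S * (T * K * S) = T * (K' * (S * T) * K) * S by
        simp only [Matrix.mul_assoc], h1, Matrix.mul_one, k2, Matrix.mul_one, h2]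
  have hreg := forall_isRegularJordanSummand_iff.2
    ⟨c, rfl, ne_zero_of_isUnit_left_listSum hunit⟩
  refine ⟨c.map jordanSummand, hreg, hsim, fun M hM => ?_, hform.congr ?_⟩
  · rcases List.mem_append.1 hM with hM | hM
    · exact .inl (hreg M hM)
    · exact .inr (hL M hM)
  · have : Subsingleton (Fin (ofSquare K).cols → k) := inferInstanceAs (Subsingleton (Fin 0 → k))
    have hc' : Equivalent 𝒜.mixing (ofSquare K) (listSum (c.map jordanSummand)) :=
      SystemEquiv.of_subsingleton _ hc
    exact (Equivalent.blockSum hc' (.refl ..)).trans (Equivalent.listSum_append ..).symm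

theorem exists_isCanonicalForm [IsAlgClosed k] [FiniteDimensional kᵐᵒᵖ V]
    (𝒜 : SubspaceMapping U) : ∃ L : List (BlockMatrix k), 𝒜.IsCanonicalForm L := by
  obtain ⟨p, K, L, h⟩ := exists_isDecomposition 𝒜
  obtain ⟨J, -, -, hJ⟩ := h.exists_jordan
  exact ⟨J ++ L, hJ⟩

/-- A canonical form is, up to the order of summands, a decomposition whose regular summand is a
direct sum of Jordan blocks. -/
theorem IsCanonicalForm.exists_isDecomposition [FiniteDimensional kᵐᵒᵖ V]
    {𝒜 : SubspaceMapping U} {L : List (BlockMatrix k)} (h : 𝒜.IsCanonicalForm L) :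
    ∃ (c : List (k × ℕ)) (L' : List (BlockMatrix k)), L.Perm (c.map jordanSummand ++ L') ∧
      𝒜.IsDecomposition (listSum (c.map jordanSummand)).left L' := by
  classical
  obtain ⟨hL, hform⟩ := h
  have hreg : ∀ M ∈ L.filter (fun M => decide M.IsRegularJordanSummand),
      M.IsRegularJordanSummand := fun M hM => by simpa using (List.mem_filter.1 hM).2
  obtain ⟨c, hc, hc0⟩ := forall_isRegularJordanSummand_iff.1 hreg
  have hperm := (List.filter_append_perm (fun M => decide M.IsRegularJordanSummand) L).symm
  rw [hc] at hperm
  refine ⟨c, _, hperm, (isUnit_untranspose_iff 𝒜).2 (isUnit_left_listSum hc0), fun M hM => ?_,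
    hform.congr ?_⟩
  · obtain ⟨h1, h2⟩ := List.mem_filter.1 hM
    exact (hL M h1).resolve_left (by simpa using h2)
  · refine (Equivalent.listSum_perm _ hperm).trans ((Equivalent.listSum_append ..).trans ?_)
    rw [eq_ofSquare_of_cols_eq_zero (cols_listSum_jordanSummand c)]
    exact .refl ..

theorem isCanonicalForm_unique [FiniteDimensional kᵐᵒᵖ V] {𝒜 : SubspaceMapping U}
    {L L' : List (BlockMatrix k)} (h : 𝒜.IsCanonicalForm L) (h' : 𝒜.IsCanonicalForm L') :
    L.Perm L' := by
  obtain ⟨c, S, hL, hd⟩ := h.exists_isDecomposition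
  obtain ⟨c', S', hL', hd'⟩ := h'.exists_isDecomposition
  obtain ⟨hsim, hperm⟩ := isDecomposition_unique 𝒜 hd hd'
  have heq := equivalent_of_similarMatrices .intoRight (similarMatrices_of_untranspose 𝒜 hsim)
  rw [← eq_ofSquare_of_cols_eq_zero (cols_listSum_jordanSummand c),
    ← eq_ofSquare_of_cols_eq_zero (cols_listSum_jordanSummand c')] at heq
  exact hL.trans ((((perm_of_equivalent_jordan heq).map _).append hperm).trans hL'.symm)

end SubspaceMapping

end Canonical

theorem theorem5 :
    -- (a) every field or skew field `F`
    (∀ (F : Type u) [DivisionRing F] (V : Type v) [AddCommGroup V] [Module Fᵐᵒᵖ V]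
        [FiniteDimensional Fᵐᵒᵖ V] (U : Submodule Fᵐᵒᵖ V) (𝒜 : SubspaceMapping U),
      (∃ (p : ℕ) (K : Matrix (Fin p) (Fin p) F) (L : List (BlockMatrix F)),
        𝒜.IsDecomposition K L) ∧
      (∀ (p p' : ℕ) (K : Matrix (Fin p) (Fin p) F) (K' : Matrix (Fin p') (Fin p') F)
          (L L' : List (BlockMatrix F)),
        𝒜.IsDecomposition K L → 𝒜.IsDecomposition K' L' →
          SimilarMatrices (𝒜.untranspose K) (𝒜.untranspose K') ∧ L.Perm L')) ∧
    -- (b) the field of complex numbers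
    (∀ (V : Type v) [AddCommGroup V] [Module ℂᵐᵒᵖ V]
        [FiniteDimensional ℂᵐᵒᵖ V] (U : Submodule ℂᵐᵒᵖ V) (𝒜 : SubspaceMapping U),
      (∀ (p : ℕ) (K : Matrix (Fin p) (Fin p) ℂ) (L : List (BlockMatrix ℂ)),
        𝒜.IsDecomposition K L →
          ∃ J : List (BlockMatrix ℂ), (∀ M ∈ J, M.IsRegularJordanSummand) ∧
            SimilarMatrices K (BlockMatrix.listSum J).left ∧ 𝒜.IsCanonicalForm (J ++ L)) ∧
      (∃ L : List (BlockMatrix ℂ), 𝒜.IsCanonicalForm L) ∧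
      (∀ L L' : List (BlockMatrix ℂ),
        𝒜.IsCanonicalForm L → 𝒜.IsCanonicalForm L' → L.Perm L')) := by
  refine ⟨fun F _ V _ _ _ U 𝒜 => ⟨exists_isDecomposition 𝒜, fun p p' K K' L L' h h' =>
    isDecomposition_unique 𝒜 h h'⟩, fun V _ _ _ U 𝒜 => ⟨fun p K L h => h.exists_jordan,
    SubspaceMapping.exists_isCanonicalForm 𝒜, fun L L' h h' =>
    SubspaceMapping.isCanonicalForm_unique h h'⟩⟩
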